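/- Let $V$ be a finite set with $n=|V|$ elements. A homogeneous relation $H$ on $V$ is a ternary relation $H(s|xy)$ on the triples $(s,x,y)\in V^3$ with $s\neq x$ and $s\neq y$ such that, for every $s\in V$, the relation $H_s=H(s|\cdot\,\cdot)$ is an equivalence relation on $V\setminus\{s\}$. A homogeneous set of $H$ is a nonempty $M\subseteq V$ such that $H(s|xy)$ for all $s\in V\setminus M$ and all $x,y\in M$. Two sets $A,B$ overlap if $A\cap B$, $A\setminus B$ and $B\setminus A$ are all nonempty. A homogeneous set is strong if it overlaps no homogeneous set. The parent of a strong homogeneous set $M\neq V$ is the smallest strong homogeneous set that properly contains $M$. **Theorem.** The strong homogeneous sets of a homogeneous relation $H$ on $V$, together with their inclusion tree, can be computed in $O(|V|^3)$ time. Precisely, there are a program for a word RAM (unit-cost operations on words of $O(\log n)$ bits) and a constant $K$ such that the following holds for every finite set $V=\{v_0,\dots,v_{n-1}\}$ and every homogeneous relation $H$ on $V$. The input is $n$ and an $n\times n$ table presenting the $n$ partitions of the sets $V\setminus\{s\}$ into the equivalence classes of $H_s$: the entry for $(s,x)$ with $x\ne s$ is a label in $\{0,\dots,n-1\}$ of the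 $H_s$-class of $x$, and the diagonal entries are arbitrary elements of $\{0,\dots,n-1\}$. On this input the program halts after at most $K(n^3+1)$ steps and outputs a list, without repetition, of all strong homogeneous sets of $H$, each given by its characteristic vector on $V$, and, for each set of the list other than $V$, the position in the list of its parent (the set $V$ being marked as the root). -/

import Mathlib

/-! ## Homogeneous relations and strong homogeneous sets -/

/-- A homogeneous relation on `V`: a relation `H(s|xy)` on the triples `(s, x, y)` with `s ≠ x` and
`s ≠ y` such that, for every `s`, the relation `H(s|··)` is an equivalence relation on `V \ {s}`. -/
structure HomogeneousRelation (V : Type*) where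
  /-- `rel s x y` is `H(s|xy)`. -/
  rel : V → V → V → Prop
  /-- `H` only relates triples `(s|xy)` with `s ≠ x` and `s ≠ y`. -/
  reflectless : ∀ s x y, rel s x y → s ≠ x ∧ s ≠ y
  symm : ∀ s x y, rel s x y ↔ rel s y x
  refl : ∀ s x, s ≠ x → rel s x x
  trans : ∀ s x y z, rel s x y → rel s y z → rel s x z

namespace HomogeneousRelation

variable {V : Type*}

/-- `X` is homogeneous with respect to `s ∉ X` if `H(s|xy)` for all `x, y ∈ X`. -/
def IsHomogeneousWrt (H : HomogeneousRelation V) (X : Set V) (s : V) : Prop :=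
  ∀ x ∈ X, ∀ y ∈ X, H.rel s x y

/-- The family of the homogeneous sets of `H`: the nonempty sets that are homogeneous with respect
to every element outside of them. -/
def family (H : HomogeneousRelation V) : Set (Set V) :=
  {M | M.Nonempty ∧ ∀ s, s ∉ M → H.IsHomogeneousWrt M s}

end HomogeneousRelation

/-- Two sets overlap if their intersection and both differences are nonempty. -/
def Overlap {V : Type*} (A B : Set V) : Prop :=
  (A ∩ B).Nonempty ∧ (A \ B).Nonempty ∧ (B \ A).Nonempty

/-- A member of a family is strong if it overlaps no member of the family. -/
def IsStrong {V : Type*} (F : Set (Set V)) (A : Set V) : Prop :=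
  A ∈ F ∧ ∀ B ∈ F, ¬ Overlap A B

/-- `P` is the parent of `M` in the family `F`: the smallest strong member of `F` that properly
contains `M`. -/
def IsParent {V : Type*} (F : Set (Set V)) (M P : Set V) : Prop :=
  IsStrong F P ∧ M ⊂ P ∧ ∀ Q, IsStrong F Q → M ⊂ Q → P ⊆ Q

/-! ## A word RAM with step counts

Programs are structured programs over integer registers `0, 1, 2, …` and random access arrays
`0, 1, 2, …`; the registers and arrays that occur in a program are named in its text, so each
program uses a fixed finite number of them. Each operation costs one step. Every number that is
computed or read has to be at most the word bound `W`; a program that violates this is stuck. -/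

namespace RAM

/-- Memory contents: `reg r` is the content of register `r`, and `mem a i` the cell of index `i` of
the array `a`. -/
structure State where
  reg : ℕ → ℕ
  mem : ℕ → ℕ → ℕ

/-- Overwrite a register. -/
def State.setReg (σ : State) (r v : ℕ) : State :=
  { σ with reg := Function.update σ.reg r v }

/-- Overwrite an array cell. -/
def State.setMem (σ : State) (a i v : ℕ) : State :=
  { σ with mem := Function.update σ.mem a (Function.update (σ.mem a) i v) }

/-- Arithmetic expressions: constants, registers, array cells, addition, truncated subtraction,
multiplication, and the tests `<` and `=` (with value `0` or `1`). -/
inductive Expr where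
  | lit (c : ℕ)
  | var (r : ℕ)
  | get (a : ℕ) (i : Expr)
  | add (x y : Expr)
  | sub (x y : Expr)
  | mul (x y : Expr)
  | lt (x y : Expr)
  | eq (x y : Expr)

/-- The value of an expression. -/
def Expr.eval (σ : State) : Expr → ℕ
  | .lit c => c
  | .var r => σ.reg r
  | .get a i => σ.mem a (i.eval σ)
  | .add x y => x.eval σ + y.eval σ
  | .sub x y => x.eval σ - y.eval σ
  | .mul x y => x.eval σ * y.eval σ
  | .lt x y => if x.eval σ < y.eval σ then 1 else 0
  | .eq x y => if x.eval σ = y.eval σ then 1 else 0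

/-- The cost of evaluating an expression: the number of its operations, including each access to a
constant, register or array cell. -/
def Expr.cost : Expr → ℕ
  | .lit _ => 1
  | .var _ => 1
  | .get _ i => i.cost + 1
  | .add x y => x.cost + y.cost + 1
  | .sub x y => x.cost + y.cost + 1
  | .mul x y => x.cost + y.cost + 1
  | .lt x y => x.cost + y.cost + 1
  | .eq x y => x.cost + y.cost + 1

/-- All values that occur in the evaluation of an expression are at most `W`. -/
def Expr.Fits (W : ℕ) (σ : State) : Expr → Prop
  | .lit c => c ≤ W
  | .var r => σ.reg r ≤ W
  | .get a i => i.Fits W σ ∧ (Expr.get a i).eval σ ≤ W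
  | .add x y => x.Fits W σ ∧ y.Fits W σ ∧ (Expr.add x y).eval σ ≤ W
  | .sub x y => x.Fits W σ ∧ y.Fits W σ ∧ (Expr.sub x y).eval σ ≤ W
  | .mul x y => x.Fits W σ ∧ y.Fits W σ ∧ (Expr.mul x y).eval σ ≤ W
  | .lt x y => x.Fits W σ ∧ y.Fits W σ ∧ (Expr.lt x y).eval σ ≤ W
  | .eq x y => x.Fits W σ ∧ y.Fits W σ ∧ (Expr.eq x y).eval σ ≤ W

/-- Programs: no operation, assignment to a register, assignment to an array cell, sequence,
conditional, and while loop. -/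
inductive Prog where
  | skip
  | assign (r : ℕ) (x : Expr)
  | store (a : ℕ) (i x : Expr)
  | seq (p q : Prog)
  | cond (b : Expr) (p q : Prog)
  | loop (b : Expr) (p : Prog)

/-- `Exec W p σ σ' t`: started in the state `σ`, with word bound `W`, the program `p` halts in the
state `σ'` after exactly `t` steps. Tests succeed when their value is nonzero. -/
inductive Exec (W : ℕ) : Prog → State → State → ℕ → Prop
  | skip (σ : State) : Exec W .skip σ σ 1
  | assign (σ : State) (r : ℕ) (x : Expr) (hx : x.Fits W σ) :
      Exec W (.assign r x) σ (σ.setReg r (x.eval σ)) (x.cost + 1)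
  | store (σ : State) (a : ℕ) (i x : Expr) (hi : i.Fits W σ) (hx : x.Fits W σ) :
      Exec W (.store a i x) σ (σ.setMem a (i.eval σ) (x.eval σ)) (i.cost + x.cost + 1)
  | seq (p q : Prog) (σ σ₁ σ₂ : State) (t₁ t₂ : ℕ)
      (hp : Exec W p σ σ₁ t₁) (hq : Exec W q σ₁ σ₂ t₂) :
      Exec W (.seq p q) σ σ₂ (t₁ + t₂)
  | cond_true (b : Expr) (p q : Prog) (σ σ₁ : State) (t : ℕ)
      (hb : b.Fits W σ) (h : b.eval σ ≠ 0) (hp : Exec W p σ σ₁ t) :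
      Exec W (.cond b p q) σ σ₁ (b.cost + 1 + t)
  | cond_false (b : Expr) (p q : Prog) (σ σ₁ : State) (t : ℕ)
      (hb : b.Fits W σ) (h : b.eval σ = 0) (hq : Exec W q σ σ₁ t) :
      Exec W (.cond b p q) σ σ₁ (b.cost + 1 + t)
  | loop_true (b : Expr) (p : Prog) (σ σ₁ σ₂ : State) (t₁ t₂ : ℕ)
      (hb : b.Fits W σ) (h : b.eval σ ≠ 0) (hp : Exec W p σ σ₁ t₁)
      (hl : Exec W (.loop b p) σ₁ σ₂ t₂) :
      Exec W (.loop b p) σ σ₂ (b.cost + 1 + t₁ + t₂)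
  | loop_false (b : Expr) (p : Prog) (σ : State)
      (hb : b.Fits W σ) (h : b.eval σ = 0) :
      Exec W (.loop b p) σ σ (b.cost + 1)

/-- The initial state on an input made of a number `n` and a table: register `0` holds `n`, array
`0` holds the table, everything else is `0`. -/
def initialState (n : ℕ) (table : ℕ → ℕ) : State where
  reg r := if r = 0 then n else 0
  mem a i := if a = 0 then table i else 0

end RAM

/-! ## Input and output conventions -/

section InputOutput

variable {V : Type*} [Fintype V]

/-- `table` presents `H` by its `n = |V|` partitions, where `V` is numbered by `e`: the entry of
index `e s * n + e x` is a label, less than `n`, of the class of `x` for the equivalence relation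
`H(s|··)` on `V \ {s}`. The labels are arbitrary, and so are the entries with `x = s`. -/
def PresentsRelation (e : V ≃ Fin (Fintype.card V)) (H : HomogeneousRelation V)
    (table : ℕ → ℕ) : Prop :=
  (∀ s x y : V, s ≠ x → s ≠ y →
    (table ((e s : ℕ) * Fintype.card V + (e x : ℕ)) =
      table ((e s : ℕ) * Fintype.card V + (e y : ℕ)) ↔ H.rel s x y)) ∧
  (∀ s x : V, table ((e s : ℕ) * Fintype.card V + (e x : ℕ)) < Fintype.card V) ∧
  (∀ i, Fintype.card V * Fintype.card V ≤ i → table i = 0)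

/-- The `i`-th subset of `V` that is written in a final state: row `i` of array `1` is its
characteristic vector. -/
def outputSet (e : V ≃ Fin (Fintype.card V)) (σ : RAM.State) (i : ℕ) : Set V :=
  {v | σ.mem 1 (i * Fintype.card V + (e v : ℕ)) ≠ 0}

/-- The final state `σ` contains the inclusion tree of the strong members of the family `F`:
with `k` the content of register `1`, the output sets of indices `0, …, k - 1` are the strong members
of `F`, each listed exactly once, and for `i < k` the entry `i` of array `2` is the index of the
parent of the `i`-th set, or `k` if that set is `V`, the root of the tree. -/
def OutputsStrongTree (e : V ≃ Fin (Fintype.card V)) (F : Set (Set V)) (σ : RAM.State) : Prop :=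
  (∀ i < σ.reg 1, IsStrong F (outputSet e σ i)) ∧
  (∀ M, IsStrong F M → ∃! i, i < σ.reg 1 ∧ outputSet e σ i = M) ∧
  (∀ i < σ.reg 1,
    (outputSet e σ i = Set.univ ∧ σ.mem 2 i = σ.reg 1) ∨
    (σ.mem 2 i < σ.reg 1 ∧ IsParent F (outputSet e σ i) (outputSet e σ (σ.mem 2 i))))

end InputOutput

/-! The combinatorial core. Two homogeneous sets that avoid z and meet have a homogeneous union, so
the maximal homogeneous sets avoiding z partition V \ {z}; `Together z` is this equivalence.
Partition refinement computes it: start from the single class V \ {z} and split a class whenever an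
element w outside of it tells two of its members apart. No homogeneous set avoiding z is ever cut,
and the final classes are homogeneous (`Refinement.split`, `Refinement.eq_iff`). A split-off class
inherits the tests already passed by the old class, so each pair (v, w) pays for at most one
successful test of the class of v against w. With O(n) rounds of O(n) overhead this is O(n²) for
each z, and O(n³) in all.

The smallest homogeneous set containing x and y consists of the z that do not have x and y together;
counting these z gives its size `dist x y`. If S is strong and x ∈ S, the hull of x and z lies in S
for z ∈ S and properly contains S for z ∉ S. Hence S is the ball about x of radius |S|
(`ball_ncard_of_isStrong`), and only the n(n + 1) pairs (x, s) are candidates. Conversely every ball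
about x is homogeneous, and it is strong if no z inside and y outside satisfy `Together z x y` or
`Together x z y` (`IsStrongBall.isStrong`).

Testing all pairs (y, z) for each candidate would be too slow. Instead, the least distance Q(x, y)
from x to an element z incomparable to y is tabulated once in O(n³) time; the test becomes the
linear check that Q(x, y) ≤ s implies dist x y ≤ s for all y. Strong sets of equal size are equal or
disjoint, so a table indexed by (element, size) detects repetitions, and the parent of a set is the
next entry in the row of any of its members.

On the machine side, all contents stay below N = (n + 2)², and expressions have bounded cost, so
intermediate values stay below a fixed power of N. Time bounds are proved with a small program logic
whose loop rule carries a potential. -/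

namespace RAM

/-! ### Word bounds -/

/-- All registers and array cells of the state are at most `N`. -/
def State.Bdd (N : ℕ) (σ : State) : Prop :=
  (∀ r, σ.reg r ≤ N) ∧ ∀ a i, σ.mem a i ≤ N

@[simp] theorem State.setReg_reg (σ : State) (r v r' : ℕ) :
    (σ.setReg r v).reg r' = if r' = r then v else σ.reg r' := by
  simp [State.setReg, Function.update_apply]

@[simp] theorem State.setReg_mem (σ : State) (r v : ℕ) : (σ.setReg r v).mem = σ.mem := rfl

@[simp] theorem State.setMem_reg (σ : State) (a i v : ℕ) : (σ.setMem a i v).reg = σ.reg := rfl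

@[simp] theorem State.setMem_mem_self (σ : State) (a i v : ℕ) :
    (σ.setMem a i v).mem a = Function.update (σ.mem a) i v := by
  simp [State.setMem]

theorem State.setMem_mem_of_ne (σ : State) {a a' : ℕ} (i v : ℕ) (h : a' ≠ a) :
    (σ.setMem a i v).mem a' = σ.mem a' := by
  simp [State.setMem, Function.update_of_ne h]

theorem State.Bdd.setReg {N : ℕ} {σ : State} (h : σ.Bdd N) (r : ℕ) {v : ℕ} (hv : v ≤ N) :
    (σ.setReg r v).Bdd N := by
  refine ⟨fun r' => ?_, h.2⟩
  rw [State.setReg_reg]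
  split_ifs
  exacts [hv, h.1 r']

theorem State.Bdd.setMem {N : ℕ} {σ : State} (h : σ.Bdd N) (a i : ℕ) {v : ℕ} (hv : v ≤ N) :
    (σ.setMem a i v).Bdd N := by
  refine ⟨h.1, fun a' i' => ?_⟩
  by_cases ha : a' = a
  · subst ha
    rw [State.setMem_mem_self, Function.update_apply]
    split_ifs
    exacts [hv, h.2 _ _]
  · rw [State.setMem_mem_of_ne _ _ _ ha]
    exact h.2 _ _

/-- The largest literal of an expression. -/
def Expr.maxLit : Expr → ℕ
  | .lit c => c
  | .var _ => 0
  | .get _ i => i.maxLit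
  | .add x y => max x.maxLit y.maxLit
  | .sub x y => max x.maxLit y.maxLit
  | .mul x y => max x.maxLit y.maxLit
  | .lt x y => max x.maxLit y.maxLit
  | .eq x y => max x.maxLit y.maxLit

/-- Each operation at most adds or multiplies, and a sum of two powers of N costs one more factor N
because N ≥ 2. Literals are limited to 2 so that they too are at most N. This reduces word bounds
for intermediate values to a decidable check on the syntax, `Small`. -/
theorem Expr.eval_le_pow_cost {N : ℕ} {σ : State} (hN : 2 ≤ N) (hσ : σ.Bdd N) (x : Expr)
    (hx : x.maxLit ≤ 2) : x.eval σ ≤ N ^ x.cost := by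
  have one (k : ℕ) : 1 ≤ N ^ k := Nat.one_le_pow _ _ (by omega)
  have mulPow (a b : ℕ) : N ^ (a + b + 1) = N ^ a * N ^ b * N := by ring
  induction x with
  | lit c => simp only [maxLit] at hx; simp only [eval, cost, pow_one]; omega
  | var r => simpa [eval, cost] using hσ.1 r
  | get a i ih =>
    simp only [eval, cost]
    exact (hσ.2 _ _).trans (Nat.le_self_pow (by omega) N)
  | add x y ihx ihy =>
    simp only [maxLit, sup_le_iff] at hx
    simp only [eval, cost, mulPow]
    nlinarith [ihx hx.1, ihy hx.2, one x.cost, one y.cost,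
      Nat.mul_le_mul (Nat.mul_le_mul (one x.cost) (le_refl (N ^ y.cost))) hN,
      Nat.mul_le_mul (Nat.mul_le_mul (le_refl (N ^ x.cost)) (one y.cost)) hN]
  | sub x y ihx ihy =>
    simp only [maxLit, sup_le_iff] at hx
    simp only [eval, cost]
    exact (Nat.sub_le _ _).trans ((ihx hx.1).trans (Nat.pow_le_pow_right (by omega) (by omega)))
  | mul x y ihx ihy =>
    simp only [maxLit, sup_le_iff] at hx
    simp only [eval, cost]
    calc _ ≤ N ^ x.cost * N ^ y.cost := Nat.mul_le_mul (ihx hx.1) (ihy hx.2)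
      _ = N ^ (x.cost + y.cost) := by ring
      _ ≤ _ := Nat.pow_le_pow_right (by omega) (by omega)
  | lt x y => simp only [eval, cost]; split_ifs <;> simp [one]
  | eq x y => simp only [eval, cost]; split_ifs <;> simp [one]

theorem Expr.fits_pow {N d : ℕ} {σ : State} (hN : 2 ≤ N) (hσ : σ.Bdd N) (x : Expr)
    (hx : x.maxLit ≤ 2) (hc : x.cost ≤ d) : x.Fits (N ^ d) σ := by
  have key : x.eval σ ≤ N ^ d :=
    (x.eval_le_pow_cost hN hσ hx).trans (Nat.pow_le_pow_right (by omega) hc)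
  induction x with
  | lit c => exact key
  | var r => exact key
  | get a i ih =>
    simp only [cost] at hc
    exact ⟨ih hx (by omega) ((i.eval_le_pow_cost hN hσ hx).trans
      (Nat.pow_le_pow_right (by omega) (by omega))), key⟩
  | add x y ihx ihy | sub x y ihx ihy | mul x y ihx ihy | lt x y ihx ihy | eq x y ihx ihy =>
    simp only [maxLit, sup_le_iff] at hx
    simp only [cost] at hc
    exact ⟨ihx hx.1 (by omega) ((x.eval_le_pow_cost hN hσ hx.1).trans
      (Nat.pow_le_pow_right (by omega) (by omega))),
      ihy hx.2 (by omega) ((y.eval_le_pow_cost hN hσ hx.2).trans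
      (Nat.pow_le_pow_right (by omega) (by omega))), key⟩

/-- The bound on the cost of expressions in the programs below. -/
abbrev maxCost : ℕ := 40

/-- Expressions with small literals and of small cost. -/
def Expr.Small (x : Expr) : Prop := x.maxLit ≤ 2 ∧ x.cost ≤ maxCost

instance (x : Expr) : Decidable x.Small := inferInstanceAs (Decidable (_ ∧ _))

/-! ### Frames -/

/-- The registers that a program assigns. -/
def Prog.regs : Prog → List ℕ
  | .skip => []
  | .assign r _ => [r]
  | .store _ _ _ => []
  | .seq p q => p.regs ++ q.regs
  | .cond _ p q => p.regs ++ q.regs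
  | .loop _ p => p.regs

/-- The arrays that a program writes to. -/
def Prog.arrs : Prog → List ℕ
  | .skip => []
  | .assign _ _ => []
  | .store a _ _ => [a]
  | .seq p q => p.arrs ++ q.arrs
  | .cond _ p q => p.arrs ++ q.arrs
  | .loop _ p => p.arrs

/-- Two states agree except on the registers and arrays written by `p`. -/
def Frame (p : Prog) (σ σ' : State) : Prop :=
  (∀ r, r ∉ p.regs → σ'.reg r = σ.reg r) ∧ ∀ a, a ∉ p.arrs → σ'.mem a = σ.mem a

theorem Frame.refl (p : Prog) (σ : State) : Frame p σ σ := ⟨fun _ _ => rfl, fun _ _ => rfl⟩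

theorem Frame.trans {p : Prog} {σ₁ σ₂ σ₃ : State} (h : Frame p σ₁ σ₂) (h' : Frame p σ₂ σ₃) :
    Frame p σ₁ σ₃ :=
  ⟨fun r hr => (h'.1 r hr).trans (h.1 r hr), fun a ha => (h'.2 a ha).trans (h.2 a ha)⟩

theorem Frame.mono {p q : Prog} {σ σ' : State} (h : Frame p σ σ') (hr : p.regs ⊆ q.regs)
    (ha : p.arrs ⊆ q.arrs) : Frame q σ σ' :=
  ⟨fun r h' => h.1 r fun h'' => h' (hr h''), fun a h' => h.2 a fun h'' => h' (ha h'')⟩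

theorem Exec.frame {W : ℕ} {p : Prog} {σ σ' : State} {t : ℕ} (h : Exec W p σ σ' t) :
    Frame p σ σ' := by
  induction h with
  | skip => exact .refl _ _
  | assign σ r x =>
    refine ⟨fun r' hr => ?_, fun _ _ => rfl⟩
    simp only [Prog.regs, List.mem_singleton] at hr
    simp [hr]
  | store σ a i x =>
    refine ⟨fun _ _ => rfl, fun a' ha => ?_⟩
    simp only [Prog.arrs, List.mem_singleton] at ha
    exact State.setMem_mem_of_ne _ _ _ ha
  | seq p q σ σ₁ σ₂ t₁ t₂ hp hq ihp ihq =>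
    exact (ihp.mono (q := .seq p q) (by simp [Prog.regs]) (by simp [Prog.arrs])).trans
      (ihq.mono (by simp [Prog.regs]) (by simp [Prog.arrs]))
  | cond_true b p q σ σ₁ t hb h hp ih =>
    exact ih.mono (by simp [Prog.regs]) (by simp [Prog.arrs])
  | cond_false b p q σ σ₁ t hb h hp ih =>
    exact ih.mono (by simp [Prog.regs]) (by simp [Prog.arrs])
  | loop_true b p σ σ₁ σ₂ t₁ t₂ hb h hp hl ihp ihl =>
    exact (ihp.mono (q := .loop b p) (by simp [Prog.regs]) (by simp [Prog.arrs])).trans ihl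
  | loop_false => exact .refl _ _

/-! ### Total correctness with time bounds -/

/-- Started in `σ`, provided all contents are at most `N`, the program `p` halts after at most `t`
steps in a state that satisfies `Q`, and all contents are still at most `N`. -/
def Run (N : ℕ) (p : Prog) (σ : State) (t : ℕ) (Q : State → Prop) : Prop :=
  2 ≤ N → σ.Bdd N →
    ∃ σ' t', Exec (N ^ maxCost) p σ σ' t' ∧ t' ≤ t ∧ σ'.Bdd N ∧ Frame p σ σ' ∧ Q σ'

variable {N : ℕ} {p q : Prog} {σ : State} {t t₁ t₂ : ℕ} {Q R : State → Prop}

theorem Run.mono (h : Run N p σ t₁ R) (ht : t₁ ≤ t)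
    (hQ : ∀ σ', Frame p σ σ' → σ'.Bdd N → R σ' → Q σ') : Run N p σ t Q := by
  intro hN hσ
  obtain ⟨σ', t', he, ht', hB, hF, hR⟩ := h hN hσ
  exact ⟨σ', t', he, ht'.trans ht, hB, hF, hQ σ' hF hB hR⟩

theorem Run.of_bdd (h : 2 ≤ N → σ.Bdd N → Run N p σ t Q) : Run N p σ t Q :=
  fun hN hσ => h hN hσ hN hσ

theorem Run.skip (h : Q σ) : Run N .skip σ 1 Q :=
  fun _ hσ => ⟨σ, 1, .skip σ, le_rfl, hσ, .refl _ _, h⟩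

theorem Run.assign {r : ℕ} {x : Expr} (hx : x.Small) (hle : σ.Bdd N → x.eval σ ≤ N)
    (h : Q (σ.setReg r (x.eval σ))) : Run N (.assign r x) σ (x.cost + 1) Q := by
  intro hN hσ
  have he := Exec.assign σ r x (x.fits_pow hN hσ hx.1 hx.2)
  exact ⟨_, _, he, le_rfl, hσ.setReg r (hle hσ), he.frame, h⟩

theorem Run.store {a : ℕ} {i x : Expr} (hi : i.Small) (hx : x.Small)
    (hle : σ.Bdd N → x.eval σ ≤ N) (h : Q (σ.setMem a (i.eval σ) (x.eval σ))) :
    Run N (.store a i x) σ (i.cost + x.cost + 1) Q := by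
  intro hN hσ
  have he := Exec.store σ a i x (i.fits_pow hN hσ hi.1 hi.2) (x.fits_pow hN hσ hx.1 hx.2)
  exact ⟨_, _, he, le_rfl, hσ.setMem a _ (hle hσ), he.frame, h⟩

theorem Run.seq (hp : Run N p σ t₁ R) (hq : ∀ σ', Frame p σ σ' → R σ' → Run N q σ' t₂ Q) :
    Run N (.seq p q) σ (t₁ + t₂) Q := by
  intro hN hσ
  obtain ⟨σ₁, s₁, he₁, hs₁, hB₁, hF₁, hR⟩ := hp hN hσ
  obtain ⟨σ₂, s₂, he₂, hs₂, hB₂, hF₂, hQ⟩ := hq σ₁ hF₁ hR hN hB₁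
  have he := Exec.seq p q σ σ₁ σ₂ s₁ s₂ he₁ he₂
  exact ⟨σ₂, _, he, by omega, hB₂, he.frame, hQ⟩

theorem Run.cond {b : Expr} (hb : b.Small) (hp : b.eval σ ≠ 0 → Run N p σ t Q)
    (hq : b.eval σ = 0 → Run N q σ t Q) : Run N (.cond b p q) σ (b.cost + 1 + t) Q := by
  intro hN hσ
  by_cases h : b.eval σ = 0
  · obtain ⟨σ₁, s₁, he₁, hs₁, hB₁, hF₁, hQ⟩ := hq h hN hσ
    have he := Exec.cond_false b p q σ σ₁ s₁ (b.fits_pow hN hσ hb.1 hb.2) h he₁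
    exact ⟨σ₁, _, he, by omega, hB₁, he.frame, hQ⟩
  · obtain ⟨σ₁, s₁, he₁, hs₁, hB₁, hF₁, hQ⟩ := hp h hN hσ
    have he := Exec.cond_true b p q σ σ₁ s₁ (b.fits_pow hN hσ hb.1 hb.2) h he₁
    exact ⟨σ₁, _, he, by omega, hB₁, he.frame, hQ⟩

/-- In amortised bounds the time depends on the final potential and is only known to exist; this
returns to an explicit bound. -/
theorem Run.of_exists (h : ∃ t, Run N p σ t fun σ' => Q σ' ∧ t ≤ t₁) : Run N p σ t₁ Q := by
  obtain ⟨s, h⟩ := h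
  intro hN hσ
  obtain ⟨_, _, _, _, _, _, _, hle⟩ := h hN hσ
  exact h.mono hle (fun _ _ _ h => h.1) hN hσ

/-- A while loop with an invariant and a potential that pays for each iteration. -/
theorem Run.loop {b : Expr} (I : State → Prop) (μ : State → ℕ) (hb : b.Small) (h0 : I σ)
    (hstep : ∀ σ', Frame (.loop b p) σ σ' → I σ' → b.eval σ' ≠ 0 →
      ∃ t, Run N p σ' t fun σ'' => I σ'' ∧ t + μ σ'' + (b.cost + 1) ≤ μ σ') :
    ∃ t, Run N (.loop b p) σ t fun σ' =>
      (I σ' ∧ b.eval σ' = 0) ∧ t + μ σ' ≤ μ σ + (b.cost + 1) := by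
  -- Outside of these hypotheses `Run` is vacuous, so any time serves.
  by_cases hNσ : 2 ≤ N ∧ σ.Bdd N
  swap
  · exact ⟨0, fun hN hσ => absurd ⟨hN, hσ⟩ hNσ⟩
  obtain ⟨hN, hσ⟩ := hNσ
  -- The potential itself is the termination measure: every iteration lowers it by at least the
  -- positive cost of the test.
  suffices H : ∀ m σ₁, μ σ₁ = m → Frame (.loop b p) σ σ₁ → I σ₁ → σ₁.Bdd N →
      ∃ σ' t', Exec (N ^ maxCost) (.loop b p) σ₁ σ' t' ∧ t' + μ σ' ≤ μ σ₁ + (b.cost + 1) ∧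
        σ'.Bdd N ∧ I σ' ∧ b.eval σ' = 0 by
    obtain ⟨σ', t', he, ht, hB, hI⟩ := H _ σ rfl (.refl _ _) h0 hσ
    exact ⟨t', fun _ _ => ⟨σ', t', he, le_rfl, hB, he.frame, hI, ht⟩⟩
  intro m
  induction m using Nat.strong_induction_on with
  | _ m ih =>
    intro σ₁ hm hF hI hB
    by_cases h : b.eval σ₁ = 0
    · exact ⟨σ₁, _, .loop_false b p σ₁ (b.fits_pow hN hB hb.1 hb.2) h, by omega, hB, hI, h⟩
    · obtain ⟨t, hrun⟩ := hstep σ₁ hF hI h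
      obtain ⟨σ₂, s₂, he₂, hs₂, hB₂, hF₂, hI₂, hμ⟩ := hrun hN hB
      obtain ⟨σ₃, s₃, he₃, hs₃, hB₃, hI₃⟩ := ih (μ σ₂) (by omega) σ₂ rfl
        (hF.trans (hF₂.mono (by simp [Prog.regs]) (by simp [Prog.arrs]))) hI₂ hB₂
      exact ⟨σ₃, _, .loop_true b p σ₁ σ₂ σ₃ s₂ s₃ (b.fits_pow hN hB hb.1 hb.2) h he₂ he₃,
        by omega, hB₃, hI₃⟩

/-! ### Counting loops -/

/-- Run `p` with the register `r` taking the values `0, …, m - 1`, for `m` the content of the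
register `b`. -/
def forLoop (r b : ℕ) (p : Prog) : Prog :=
  .seq (.assign r (.lit 0))
    (.loop (.lt (.var r) (.var b)) (.seq p (.assign r (.add (.var r) (.lit 1)))))

/-- Each iteration costs 4 for the test and 4 for the increment; the final 6 is 2 for the
initialisation and 4 for the failing test. -/
theorem Run.forLoop_potential {r b m : ℕ} (I : ℕ → State → Prop) (μ : ℕ → State → ℕ)
    (hm : σ.reg b = m) (hr : r ∉ p.regs) (hb : b ∉ p.regs) (hrb : b ≠ r)
    (h0 : I 0 (σ.setReg r 0))
    (hstep : ∀ k < m, ∀ σ', Frame (forLoop r b p) σ σ' → σ'.reg r = k → I k σ' →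
      ∃ t, Run N p σ' t fun σ'' => I (k + 1) (σ''.setReg r (k + 1)) ∧
        t + μ (k + 1) (σ''.setReg r (k + 1)) ≤ μ k σ') :
    ∃ t, Run N (forLoop r b p) σ t fun σ' =>
      I m σ' ∧ t + μ m σ' ≤ μ 0 (σ.setReg r 0) + 8 * m + 6 := by
  by_cases hNσ : 2 ≤ N ∧ σ.Bdd N
  swap
  · exact ⟨0, fun hN hσ => absurd ⟨hN, hσ⟩ hNσ⟩
  obtain ⟨hN, hσ⟩ := hNσ
  have hmN : m ≤ N := hm ▸ hσ.1 b
  have hF₁ : Frame (.assign r (.lit 0)) σ (σ.setReg r 0) :=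
    ⟨fun r' hr' => by simp_all [Prog.regs], fun _ _ => rfl⟩
  set σ₁ := σ.setReg r 0 with hσ₁
  refine (Run.loop (N := N) (b := .lt (.var r) (.var b))
    (p := .seq p (.assign r (.add (.var r) (.lit 1)))) (σ := σ₁)
    (fun σ' => σ'.reg r ≤ m ∧ σ'.reg b = m ∧ I (σ'.reg r) σ')
    (fun σ' => μ (σ'.reg r) σ' + 8 * (m - σ'.reg r))
    (by simp [Expr.Small, Expr.maxLit, Expr.cost, maxCost]) (by simpa [hσ₁, hrb, hm] using h0)
    ?_).elim fun t hloop => ?_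
  rotate_left
  · refine ⟨2 + t, .seq (R := fun σ' => σ' = σ₁) ?_ ?_⟩
    · exact Run.assign (by decide) (fun _ => by simp [Expr.eval]) (by simp [Expr.eval, hσ₁])
    rintro σ₂ - hσ₂
    rw [hσ₂]
    refine hloop.mono le_rfl ?_
    rintro σ' _ _ ⟨⟨⟨h1, h2, h3⟩, h4⟩, h5⟩
    have h6 : σ'.reg r = m := by
      by_contra hne
      simp only [Expr.eval, h2] at h4
      rw [if_pos (by omega)] at h4
      omega
    rw [h6] at h3 h5
    have h7 : σ₁.reg r = 0 := by simp [hσ₁]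
    simp only [h7, Expr.cost] at h5
    exact ⟨h3, by omega⟩
  · rintro σ' hF ⟨h1, h2, h3⟩ h4
    have hk : σ'.reg r < m := by
      by_contra hne
      simp [Expr.eval, h2, hne] at h4
    have hF' : Frame (forLoop r b p) σ σ' :=
      (hF₁.mono (by simp [forLoop, Prog.regs]) (by simp [forLoop, Prog.arrs])).trans
        (hF.mono (by simp [forLoop, Prog.regs]) (by simp [forLoop, Prog.arrs]))
    obtain ⟨t, ht⟩ := hstep _ hk σ' hF' rfl h3
    refine ⟨t + 4, Run.seq ht ?_⟩
    rintro σ₂ hF₂ ⟨h5, h6⟩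
    have hr₂ : σ₂.reg r = σ'.reg r := hF₂.1 r hr
    refine Run.assign (by simp [Expr.Small, Expr.maxLit, Expr.cost, maxCost]) (fun _ => ?_) ?_
    · simp only [Expr.eval, hr₂]; omega
    · simp only [Expr.eval, hr₂, State.setReg_reg, if_true, hrb, if_false, hF₂.1 b hb, h2, h5,
        Expr.cost]
      refine ⟨⟨by omega, trivial, trivial⟩, by omega⟩

theorem Run.forLoop {r b m T : ℕ} (I : ℕ → State → Prop)
    (hm : σ.reg b = m) (hr : r ∉ p.regs) (hb : b ∉ p.regs) (hrb : b ≠ r)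
    (h0 : I 0 (σ.setReg r 0))
    (hstep : ∀ k < m, ∀ σ', Frame (forLoop r b p) σ σ' → σ'.reg r = k → I k σ' →
      Run N p σ' T fun σ'' => I (k + 1) (σ''.setReg r (k + 1))) :
    Run N (RAM.forLoop r b p) σ (m * (T + 8) + 6) (I m) := by
  refine (Run.forLoop_potential I (fun k _ => (m - k) * T) hm hr hb hrb h0 (N := N) ?_).elim
    fun t ht => ?_
  rotate_left
  · refine Run.of_exists ⟨t, ht.mono le_rfl fun σ' _ _ h => ⟨h.1, ?_⟩⟩
    have := h.2
    simp at this
    ring_nf at this ⊢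
    omega
  intro k hk σ' hF hσ' hI
  refine ⟨T, (hstep k hk σ' hF hσ' hI).mono le_rfl fun σ'' _ _ h => ⟨h, ?_⟩⟩
  obtain ⟨j, rfl⟩ : ∃ j, m = k + 1 + j := ⟨m - (k + 1), by omega⟩
  rw [show k + 1 + j - (k + 1) = j by omega, show k + 1 + j - k = j + 1 by omega]
  ring_nf; rfl

/-- Add the values of `x` for `r = 0, …, m - 1` up in the register `acc`. -/
def sumLoop (acc r b : ℕ) (x : Expr) : Prog :=
  .seq (.assign acc (.lit 0)) (forLoop r b (.assign acc (.add (.var acc) x)))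

theorem Run.sumLoop {acc r b m : ℕ} {x : Expr} (f : ℕ → ℕ)
    (hm : σ.reg b = m) (hra : r ≠ acc) (hb : b ≠ acc) (hrb : b ≠ r)
    (hx : (Expr.add (.var acc) x).Small)
    (hf : ∀ k < m, ∀ σ', Frame (sumLoop acc r b x) σ σ' → σ'.reg r = k → x.eval σ' = f k)
    (hN : ∑ i ∈ Finset.range m, f i ≤ N) :
    Run N (RAM.sumLoop acc r b x) σ (m * (x.cost + 11) + 8)
      fun σ' => σ'.reg acc = ∑ i ∈ Finset.range m, f i := by
  refine Run.mono (t₁ := 2 + (m * (x.cost + 3 + 8) + 6))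
    (.seq (R := fun σ' => σ' = σ.setReg acc 0) ?_ ?_) (by ring_nf; omega)
    (fun _ _ _ h => h)
  · exact Run.assign (by decide) (fun _ => by simp [Expr.eval]) (by simp [Expr.eval])
  rintro σ₁ hF₁ rfl
  refine Run.forLoop (fun k σ' => σ'.reg acc = ∑ i ∈ Finset.range k, f i) ?_ ?_ ?_ hrb ?_ ?_
  · simp [hb, hm]
  · simp [Prog.regs, hra]
  · simp [Prog.regs, hb]
  · simp [hra.symm]
  · intro k hk σ' hF hr hI
    have hF' : Frame (RAM.sumLoop acc r b x) σ σ' :=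
      (hF₁.mono (by simp [RAM.sumLoop, Prog.regs]) (by simp [RAM.sumLoop, Prog.arrs])).trans
        (hF.mono (by simp [RAM.sumLoop, Prog.regs]) (by simp [RAM.sumLoop, Prog.arrs]))
    have hxk := hf k hk σ' hF' hr
    refine (Run.assign hx (fun _ => ?_) ?_).mono (by simp [Expr.cost]; omega) (fun _ _ _ h => h)
    · simp only [Expr.eval, hI, hxk]
      rw [← Finset.sum_range_succ]
      exact (Finset.sum_le_sum_of_subset (by simpa using hk)).trans hN
    · simp [Expr.eval, hI, hxk, hra.symm, Finset.sum_range_succ]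

/-- Store the values of `x` for `r = 0, …, m - 1` in the cells of `a` with index `i`. -/
def storeLoop (r b a : ℕ) (i x : Expr) : Prog := forLoop r b (.store a i x)

/-- The stored expression may read the array being overwritten, so the step hypothesis records that
all cells not yet visited are unchanged. -/
theorem Run.storeLoop {r b a m : ℕ} {i x : Expr} (g f : ℕ → ℕ)
    (hm : σ.reg b = m) (hrb : b ≠ r) (hi : i.Small) (hx : x.Small)
    (hinj : ∀ k < m, ∀ l < m, g k = g l → k = l)
    (hstep : ∀ k < m, ∀ σ', Frame (storeLoop r b a i x) σ σ' → σ'.reg r = k →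
      (∀ j, (∀ l < k, j ≠ g l) → σ'.mem a j = σ.mem a j) →
      i.eval σ' = g k ∧ x.eval σ' = f k)
    (hN : ∀ k < m, σ.Bdd N → f k ≤ N) :
    Run N (RAM.storeLoop r b a i x) σ (m * (i.cost + x.cost + 9) + 6)
      fun σ' => (∀ k < m, σ'.mem a (g k) = f k) ∧
        ∀ j, (∀ k < m, j ≠ g k) → σ'.mem a j = σ.mem a j := by
  refine Run.of_bdd fun _ hσ => ?_
  refine (Run.forLoop (T := i.cost + x.cost + 1) (fun k σ' => (∀ l < k, σ'.mem a (g l) = f l) ∧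
    ∀ j, (∀ l < k, j ≠ g l) → σ'.mem a j = σ.mem a j) hm ?_ ?_ hrb ?_ ?_).mono
    le_rfl (fun _ _ _ h => h)
  · simp [Prog.regs]
  · simp [Prog.regs]
  · simp
  · rintro k hk σ' hF hr ⟨h1, h2⟩
    obtain ⟨hg, hf⟩ := hstep k hk σ' hF hr h2
    refine Run.store hi hx (fun _ => hf ▸ hN k hk hσ) ?_
    simp only [hg, hf, State.setReg_mem, State.setMem_mem_self, Function.update_apply]
    refine ⟨fun l hl => ?_, fun j hj => ?_⟩
    · split_ifs with h
      · rw [hinj l (by omega) k hk h]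
      · refine h1 l (lt_of_le_of_ne (by omega) ?_)
        rintro rfl
        exact h rfl
    · rw [if_neg (hj k (by omega))]
      exact h2 j fun l hl => hj l (by omega)

end RAM

/-! ### The smallest homogeneous set that contains two elements -/

namespace HomogeneousRelation

variable {V : Type*} {H : HomogeneousRelation V}

/-- Some homogeneous set that avoids `z` contains `x` and `y`. -/
def Together (H : HomogeneousRelation V) (z x y : V) : Prop :=
  ∃ X ∈ H.family, z ∉ X ∧ x ∈ X ∧ y ∈ X

theorem singleton_mem_family (x : V) : {x} ∈ H.family := by
  refine ⟨Set.singleton_nonempty x, fun s hs a ha b hb => ?_⟩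
  rw [Set.mem_singleton_iff] at ha hb hs
  subst ha hb
  exact H.refl _ _ hs

/-- For s outside of the union, every element is related to a common element c, and transitivity
through c concludes. -/
theorem union_mem_family {A B : Set V} (hA : A ∈ H.family) (hB : B ∈ H.family)
    (h : (A ∩ B).Nonempty) : A ∪ B ∈ H.family := by
  obtain ⟨c, hcA, hcB⟩ := h
  refine ⟨⟨c, .inl hcA⟩, fun s hs a ha b hb => ?_⟩
  rw [Set.mem_union, not_or] at hs
  have key : ∀ a ∈ A ∪ B, H.rel s a c := by
    rintro a (ha | ha)
    exacts [hA.2 s hs.1 a ha c hcA, hB.2 s hs.2 a ha c hcB]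
  exact H.trans s a c b (key a ha) ((H.symm _ _ _).1 (key b hb))

theorem Together.symm {z x y : V} (h : H.Together z x y) : H.Together z y x := by
  obtain ⟨X, hX, hz, hx, hy⟩ := h
  exact ⟨X, hX, hz, hy, hx⟩

theorem Together.trans {z x y w : V} (h : H.Together z x y) (h' : H.Together z y w) :
    H.Together z x w := by
  obtain ⟨X, hX, hz, hx, hy⟩ := h
  obtain ⟨Y, hY, hz', hy', hw⟩ := h'
  exact ⟨X ∪ Y, union_mem_family hX hY ⟨y, hy, hy'⟩, by simp [hz, hz'], .inl hx, .inr hw⟩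

theorem Together.rel {z x y : V} (h : H.Together z x y) : H.rel z x y := by
  obtain ⟨X, hX, hz, hx, hy⟩ := h
  exact hX.2 z hz x hx y hy

/-- The smallest homogeneous set that contains `x` and `y`. -/
def hull (H : HomogeneousRelation V) (x y : V) : Set V := {z | ¬ H.Together z x y}

theorem left_mem_hull (x y : V) : x ∈ H.hull x y := fun ⟨_, _, hz, hx, _⟩ => hz hx

theorem right_mem_hull (x y : V) : y ∈ H.hull x y := fun ⟨_, _, hz, _, hy⟩ => hz hy

theorem hull_subset {X : Set V} (hX : X ∈ H.family) {x y : V} (hx : x ∈ X) (hy : y ∈ X) :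
    H.hull x y ⊆ X := fun z hz => by
  by_contra h
  exact hz ⟨X, hX, h, hx, hy⟩

/-- An element s outside of the hull is avoided by some homogeneous X containing x and y; X contains
the hull and is homogeneous with respect to s. -/
theorem hull_mem_family (x y : V) : H.hull x y ∈ H.family := by
  refine ⟨⟨x, left_mem_hull x y⟩, fun s hs a ha b hb => ?_⟩
  obtain ⟨X, hX, hz, hx, hy⟩ := not_not.1 hs
  exact hX.2 s hz a (hull_subset hX hx hy ha) b (hull_subset hX hx hy hb)

/-- The size of the hull of `x` and `y` if `x ≠ y`, and `0` if `x = y`. -/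
noncomputable def dist (H : HomogeneousRelation V) (x y : V) : ℕ :=
  open scoped Classical in if x = y then 0 else (H.hull x y).ncard

/-- The elements at distance at most `s` from `x`. -/
def ball (H : HomogeneousRelation V) (x : V) (s : ℕ) : Set V := {z | H.dist x z ≤ s}

/-- The test that decides whether the ball is a strong homogeneous set of size `s`. -/
def IsStrongBall (H : HomogeneousRelation V) (x : V) (s : ℕ) : Prop :=
  (H.ball x s).ncard = s ∧
    ∀ y z, z ∈ H.ball x s → y ∉ H.ball x s → ¬ H.Together z x y ∧ ¬ H.Together x z y

theorem self_mem_ball (x : V) (s : ℕ) : x ∈ H.ball x s := by simp [ball, dist]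

/-! ### Strong homogeneous sets as balls. -/

variable [Finite V]

theorem ball_ncard_of_isStrong {S : Set V} (hS : IsStrong H.family S) {x : V} (hx : x ∈ S) :
    H.ball x S.ncard = S := by
  ext z
  simp only [ball, dist, Set.mem_ofPred_eq]
  constructor
  · intro h
    by_contra hz
    have hne : x ≠ z := by rintro rfl; exact hz hx
    rw [if_neg hne] at h
    -- The hull meets S in x and leaves S through z; as S overlaps nothing, it must be swallowed,
    -- and then the hull is strictly larger.
    have hsub : S ⊆ H.hull x z := by
      by_contra hcon
      exact hS.2 _ (hull_mem_family x z) ⟨⟨x, hx, left_mem_hull x z⟩,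
        Set.sdiff_nonempty.2 hcon, ⟨z, right_mem_hull x z, hz⟩⟩
    have : S.ncard < (H.hull x z).ncard :=
      Set.ncard_lt_ncard ⟨hsub, fun h' => hz (h' (right_mem_hull x z))⟩
    omega
  · intro hz
    split_ifs
    · omega
    · exact Set.ncard_le_ncard (hull_subset hS.1 hx hz)

theorem isStrongBall_ncard_of_isStrong {S : Set V} (hS : IsStrong H.family S) {x : V}
    (hx : x ∈ S) : H.IsStrongBall x S.ncard := by
  have key {x y z : V} (hx : x ∈ S) (hz : z ∈ S) (hy : y ∉ S) : ¬ H.Together z x y := by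
    rintro ⟨B, hB, hzB, hxB, hyB⟩
    exact hS.2 B hB ⟨⟨x, hx, hxB⟩, ⟨z, hz, hzB⟩, ⟨y, hyB, hy⟩⟩
  rw [IsStrongBall, ball_ncard_of_isStrong hS hx]
  exact ⟨rfl, fun y z hz hy => ⟨key hx hz hy, key hz hx hy⟩⟩

theorem IsStrongBall.isStrong {x : V} {s : ℕ} (h : H.IsStrongBall x s) :
    IsStrong H.family (H.ball x s) := by
  have hx := H.self_mem_ball x s
  -- Otherwise y lies in the hull of x and z, so the hull of x and y is no larger and y lies in the
  -- ball. Chaining these relations through x makes any ball homogeneous; the second clause of the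
  -- test serves only to exclude overlaps.
  have sep {y z : V} (hz : z ∈ H.ball x s) (hy : y ∉ H.ball x s) : H.Together y x z := by
    by_contra hcon
    have hxz : x ≠ z := by
      rintro rfl
      refine hcon ⟨{x}, singleton_mem_family x, ?_, rfl, rfl⟩
      rintro rfl
      exact hy hz
    have hxy : x ≠ y := by rintro rfl; exact hy hx
    apply hy
    have hle := Set.ncard_le_ncard (hull_subset (hull_mem_family x z) (left_mem_hull x z) hcon)
    simp only [ball, dist, Set.mem_ofPred_eq, if_neg hxz, if_neg hxy] at hz ⊢
    omega
  refine ⟨⟨⟨x, hx⟩, fun y hy a ha b hb => ?_⟩, ?_⟩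
  · exact ((sep ha hy).symm.trans (sep hb hy)).rel
  · rintro B hB ⟨⟨a, ha, haB⟩, ⟨b, hb, hbB⟩, ⟨y, hyB, hy⟩⟩
    -- If B misses the center, then B puts a and y together with respect to x; if B contains it,
    -- then B puts x and y together with respect to b. The test forbids both.
    have hxB : x ∈ B := by
      by_contra hxB
      exact (h.2 y a ha hy).2 ⟨B, hB, hxB, haB, hyB⟩
    exact (h.2 y b hb hy).1 ⟨B, hB, hbB, hxB, hyB⟩

/-- Every element of a strong ball is a center of it. -/
theorem IsStrongBall.recenter {x v : V} {s : ℕ} (h : H.IsStrongBall x s) (hv : v ∈ H.ball x s) :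
    H.IsStrongBall v s ∧ H.ball v s = H.ball x s := by
  have h1 := isStrongBall_ncard_of_isStrong h.isStrong hv
  have h2 := ball_ncard_of_isStrong h.isStrong hv
  rw [h.1] at h1 h2
  exact ⟨h1, h2⟩

end HomogeneousRelation

/-! ### Partition refinement -/

theorem rowIndex_inj {n x y x' y' : ℕ} (hy : y < n) (hy' : y' < n) :
    x * n + y = x' * n + y' ↔ x = x' ∧ y = y' := by
  refine ⟨fun h => ?_, fun ⟨h, h'⟩ => by rw [h, h']⟩
  rcases lt_trichotomy x x' with hx | rfl | hx
  · have := Nat.mul_le_mul_right n (Nat.succ_le_of_lt hx)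
    rw [Nat.succ_mul] at this
    omega
  · exact ⟨rfl, by omega⟩
  · have := Nat.mul_le_mul_right n (Nat.succ_le_of_lt hx)
    rw [Nat.succ_mul] at this
    omega

/-- Some set of numbers below `n` that avoids `z` and is homogeneous for the table contains `x`
and `y`. -/
def TableTogether (n : ℕ) (tab : ℕ → ℕ) (z x y : ℕ) : Prop :=
  ∃ X : Set ℕ, (∀ s < n, s ∉ X → ∀ x ∈ X, ∀ y ∈ X, tab (s * n + x) = tab (s * n + y)) ∧
    (∀ x ∈ X, x < n) ∧ z ∉ X ∧ x ∈ X ∧ y ∈ X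

/-- The invariant of the refinement, for `z`, of the partition into the classes `L ⁻¹ {p}`, `p < c`:
`U (p * n + w) ≠ 0` if the class `p` has been found to be homogeneous with respect to `w`, and the
classes below `q` are finished. -/
structure Refinement (n : ℕ) (tab : ℕ → ℕ) (z : ℕ) (L U : ℕ → ℕ) (q c : ℕ) : Prop where
  lt : ∀ v < n, L v < c
  zero : ∀ v < n, L v = 0 ↔ v = z
  sound : ∀ x < n, ∀ y < n, TableTogether n tab z x y → L x = L y
  used : ∀ p < c, 1 ≤ p → ∀ w < n, U (p * n + w) ≠ 0 → L w ≠ p ∧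
    ∀ x < n, ∀ y < n, L x = p → L y = p → tab (w * n + x) = tab (w * n + y)
  done : ∀ p, 1 ≤ p → p < q → ∀ w < n, L w ≠ p → U (p * n + w) ≠ 0
  nonempty : ∀ p < c, p ≠ 1 → ∃ v < n, L v = p
  one_le : 1 ≤ q
  le : q ≤ c
  two_le : 2 ≤ c

namespace Refinement

variable {n : ℕ} {tab : ℕ → ℕ} {z q c : ℕ} {L U : ℕ → ℕ}

theorem init (hz : z < n) (hL : ∀ v < n, L v = if v = z then 0 else 1)
    (hU : ∀ w < n, U (n + w) = 0) : Refinement n tab z L U 1 2 where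
  lt v hv := by rw [hL v hv]; split_ifs <;> omega
  zero v hv := by rw [hL v hv]; simp
  sound x hx y hy := by
    rintro ⟨X, -, -, hzX, hxX, hyX⟩
    rw [hL x hx, hL y hy, if_neg, if_neg] <;> rintro rfl <;> contradiction
  used p hp hp1 w hw h := by
    obtain rfl : p = 1 := by omega
    rw [one_mul] at h
    exact absurd (hU w hw) h
  done p hp hp1 := by omega
  nonempty p hp hp1 := by
    obtain rfl : p = 0 := by omega
    exact ⟨z, hz, by simp [hL z hz]⟩
  one_le := le_rfl
  le := by omega
  two_le := le_rfl

/-- All labels but 1 are taken. Class 1 starts as V \ {z}, which is empty when n = 1, so it has to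
be excepted. -/
theorem le_succ (h : Refinement n tab z L U q c) : c ≤ n + 1 := by
  have hsub : (Finset.range c).erase 1 ⊆ (Finset.range n).image L := by
    intro p hp
    rw [Finset.mem_erase, Finset.mem_range] at hp
    obtain ⟨v, hv, rfl⟩ := h.nonempty p hp.2 hp.1
    exact Finset.mem_image_of_mem _ (Finset.mem_range.2 hv)
  have h1 := (Finset.card_le_card hsub).trans Finset.card_image_le
  have h2 := h.two_le
  rw [Finset.card_erase_of_mem (Finset.mem_range.2 h2), Finset.card_range, Finset.card_range] at h1
  omega

theorem mark (h : Refinement n tab z L U q c) {w : ℕ} (hw : w < n) (hwq : L w ≠ q)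
    (heq : ∀ x < n, ∀ y < n, L x = q → L y = q → tab (w * n + x) = tab (w * n + y)) :
    Refinement n tab z L (Function.update U (q * n + w) 1) q c where
  __ := h
  used p hp hp1 w' hw' h' := by
    rw [Function.update_apply] at h'
    split_ifs at h' with hcase
    · obtain ⟨rfl, rfl⟩ := (rowIndex_inj hw' hw).1 hcase
      exact ⟨hwq, heq⟩
    · exact h.used p hp hp1 w' hw' h'
  done p hp hp1 w' hw' h' := by
    rw [Function.update_apply]
    split_ifs
    · exact one_ne_zero
    · exact h.done p hp hp1 w' hw' h'

theorem advance (h : Refinement n tab z L U q c) (hq : q < c)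
    (hall : ∀ w < n, L w ≠ q → U (q * n + w) ≠ 0) :
    Refinement n tab z L U (q + 1) c where
  __ := h
  done p hp hp1 w hw h' := by
    rcases (Nat.lt_succ_iff_lt_or_eq.1 hp1) with hlt | rfl
    · exact h.done p hp hlt w hw h'
    · exact hall w hw h'
  one_le := by omega
  le := hq

/-- The members of class q that w tells from x₀ move to the new class c. Both parts are subsets of
the old class, so both keep the elements against which it has been found homogeneous: row q of `U`
is copied to row c. The class at q stays unfinished and is examined again. -/
theorem split (h : Refinement n tab z L U q c) (hq : q < c) {L' U' : ℕ → ℕ}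
    {w x₀ : ℕ} (hw : w < n) (hwq : L w ≠ q)
    (hx₀ : x₀ < n) (hx₀q : L x₀ = q)
    (hex : ∃ v < n, L v = q ∧ tab (w * n + v) ≠ tab (w * n + x₀))
    (hL : ∀ v < n, L' v = if L v = q ∧ tab (w * n + v) ≠ tab (w * n + x₀) then c else L v)
    (hUc : ∀ v < n, U' (c * n + v) = U (q * n + v))
    (hU : ∀ p < c, ∀ v < n, U' (p * n + v) = U (p * n + v)) :
    Refinement n tab z L' U' q (c + 1) where
  lt v hv := by
    rw [hL v hv]
    split_ifs
    · omega
    · exact (h.lt v hv).trans (Nat.lt_succ_self c)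
  zero v hv := by
    have := h.one_le
    rw [hL v hv, ← h.zero v hv]
    split_ifs <;> omega
  sound x hx y hy hxy := by
    have hLxy := h.sound x hx y hy hxy
    rw [hL x hx, hL y hy, hLxy]
    by_cases hyq : L y = q
    · obtain ⟨X, hX, hXn, hzX, hxX, hyX⟩ := hxy
      -- X lies within one class by soundness so far, and w is outside of that class; thus w cannot
      -- separate members of X.
      have hwX : w ∉ X := fun hwX =>
        hwq ((h.sound w hw y hy ⟨X, hX, hXn, hzX, hwX, hyX⟩).trans hyq)
      rw [hX w hw hwX x hxX y hyX]
    · simp [hyq]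
  used p hp hp1 w' hw' h' := by
    have hcL (v : ℕ) (hv : v < n) : L v ≠ c := (h.lt v hv).ne
    rcases (Nat.lt_succ_iff_lt_or_eq.1 hp) with hlt | rfl
    · rw [hU p hlt w' hw'] at h'
      obtain ⟨h1, h2⟩ := h.used p hlt hp1 w' hw' h'
      have key (v : ℕ) (hv : v < n) (hvp : L' v = p) : L v = p := by
        rw [hL v hv] at hvp
        split_ifs at hvp
        · omega
        · exact hvp
      exact ⟨fun h3 => h1 (key w' hw' h3),
        fun x hx y hy hxp hyp => h2 x hx y hy (key x hx hxp) (key y hy hyp)⟩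
    · rw [hUc w' hw'] at h'
      obtain ⟨h1, h2⟩ := h.used q hq h.one_le w' hw' h'
      have key (v : ℕ) (hv : v < n) (hvp : L' v = p) : L v = q := by
        rw [hL v hv] at hvp
        split_ifs at hvp with hc
        · exact hc.1
        · exact absurd hvp (hcL v hv)
      exact ⟨fun h3 => h1 (key w' hw' h3),
        fun x hx y hy hxp hyp => h2 x hx y hy (key x hx hxp) (key y hy hyp)⟩
  done p hp hp1 w' hw' h' := by
    rw [hU p (hp1.trans hq) w' hw']
    refine h.done p hp hp1 w' hw' ?_
    rw [hL w' hw'] at h'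
    split_ifs at h' with hc
    · omega
    · exact h'
  nonempty p hp hp1 := by
    rcases (Nat.lt_succ_iff_lt_or_eq.1 hp) with hlt | rfl
    · by_cases hpq : p = q
      · exact ⟨x₀, hx₀, by rw [hL x₀ hx₀]; simp [hx₀q, hpq]⟩
      · obtain ⟨v, hv, hvp⟩ := h.nonempty p hlt hp1
        exact ⟨v, hv, by rw [hL v hv, if_neg (fun hc => hpq (hvp.symm.trans hc.1)), hvp]⟩
    · obtain ⟨v, hv, hvq⟩ := hex
      exact ⟨v, hv, by rw [hL v hv, if_pos hvq]⟩
  one_le := h.one_le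
  le := h.le.trans (Nat.le_succ c)
  two_le := h.two_le.trans (Nat.le_succ c)

theorem eq_iff (h : Refinement n tab z L U q c) (hq : q = c) {x y : ℕ} (hx : x < n) (hy : y < n) :
    L x = L y ↔ (x = z ∧ y = z) ∨ TableTogether n tab z x y := by
  constructor
  · intro hxy
    by_cases hxz : x = z
    · exact .inl ⟨hxz, (h.zero y hy).1 (hxy ▸ (h.zero x hx).2 hxz)⟩
    · right
      have hLx : 1 ≤ L x := Nat.one_le_iff_ne_zero.2 fun h0 => hxz ((h.zero x hx).1 h0)
      -- The finished class of x is itself the required homogeneous set avoiding z.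
      refine ⟨{v | v < n ∧ L v = L x}, ?_, fun v hv => hv.1, ?_, ⟨hx, rfl⟩, ⟨hy, hxy.symm⟩⟩
      · intro s hs hsX a ha b hb
        have hne : L s ≠ L x := fun h' => hsX ⟨hs, h'⟩
        have hU := h.done (L x) hLx (hq ▸ h.lt x hx) s hs hne
        exact (h.used (L x) (h.lt x hx) hLx s hs hU).2 a ha.1 b hb.1 ha.2 hb.2
      · rintro ⟨hz, hzx⟩
        have := (h.zero z hz).2 rfl
        omega
  · rintro (⟨rfl, rfl⟩ | hxy)
    · rfl
    · exact h.sound x hx y hy hxy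

end Refinement

/-- The number of pairs `(v, w)` such that `w` has not been tested against the class of `v`. -/
def untested (n : ℕ) (L U : ℕ → ℕ) : ℕ :=
  ∑ v ∈ Finset.range n, ∑ w ∈ Finset.range n, if U (L v * n + w) = 0 then 1 else 0

theorem untested_le (n : ℕ) (L U : ℕ → ℕ) : untested n L U ≤ n * n := by
  refine (Finset.sum_le_card_nsmul _ _ n fun v _ => ?_).trans (by simp)
  refine (Finset.sum_le_card_nsmul _ _ 1 fun v _ => ?_).trans (by simp)
  split_ifs <;> omega

theorem untested_congr {n : ℕ} {L U L' U' : ℕ → ℕ}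
    (h : ∀ v < n, ∀ w < n, U' (L' v * n + w) = U (L v * n + w)) :
    untested n L' U' = untested n L U := by
  refine Finset.sum_congr rfl fun v hv => Finset.sum_congr rfl fun w hw => ?_
  rw [h v (Finset.mem_range.1 hv) w (Finset.mem_range.1 hw)]

/-- One mark settles the pair (v, w) for every v in class q, so the potential drops by the size of
the class, which is what the test cost up to a constant factor. -/
theorem untested_mark {n : ℕ} {L U : ℕ → ℕ} {q w : ℕ} (hw : w < n) (hU : U (q * n + w) = 0) :
    untested n L (Function.update U (q * n + w) 1) +
      ((Finset.range n).filter fun v => L v = q).card = untested n L U := by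
  rw [Finset.card_filter, untested, untested, ← Finset.sum_add_distrib]
  refine Finset.sum_congr rfl fun v _ => ?_
  have hne (w' : ℕ) (hw' : w' ∈ (Finset.range n).erase w) :
      (if Function.update U (q * n + w) 1 (L v * n + w') = 0 then 1 else 0) =
        if U (L v * n + w') = 0 then 1 else 0 := by
    rw [Finset.mem_erase, Finset.mem_range] at hw'
    rw [Function.update_of_ne]
    rw [Ne, rowIndex_inj hw'.2 hw]
    exact fun h => hw'.1 h.2
  have hmem := Finset.mem_range.2 hw
  rw [← Finset.add_sum_erase _ _ hmem, ← Finset.add_sum_erase _ (fun w => ite _ _ _) hmem,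
    Finset.sum_congr rfl hne]
  by_cases hv : L v = q
  · simp [hv, hU]; omega
  · rw [Function.update_of_ne]
    · simp [hv]
    · rw [Ne, rowIndex_inj hw hw]
      exact fun h => hv h.1

/-! ### Programs for the partition refinement and their amortised cost. -/

namespace RAM

variable {N n : ℕ} {σ : State}

/-- The index of the entry in row `i` and column `j` of a table with row length in register `r`. -/
abbrev Expr.row (i : Expr) (r : ℕ) (j : Expr) : Expr := .add (.mul i (.var r)) j

/-- Negation of a test. -/
abbrev Expr.not (b : Expr) : Expr := .sub (.lit 1) b

theorem one_sub_ite_ne_zero {P : Prop} [Decidable P] : 1 - (if P then 1 else 0) ≠ 0 ↔ ¬ P := by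
  split_ifs <;> simpa

/-! ### The list of the members of a class -/

/-- `B 0, …, B (m - 1)` are the numbers `v < n` with `L v = q`. -/
structure IsListOf (n : ℕ) (L : ℕ → ℕ) (q : ℕ) (B : ℕ → ℕ) (m : ℕ) : Prop where
  card_eq : ((Finset.range n).filter fun v => L v = q).card = m
  mem : ∀ j < m, B j < n ∧ L (B j) = q
  surj : ∀ v < n, L v = q → ∃ j < m, B j = v

theorem IsListOf.le {L B : ℕ → ℕ} {q m : ℕ} (h : IsListOf n L q B m) : m ≤ n := by
  rw [← h.card_eq]
  exact (Finset.card_filter_le _ _).trans (by simp)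

theorem IsListOf.append {L B : ℕ → ℕ} {q m : ℕ} (h : IsListOf n L q B m) (hq : L n = q) :
    IsListOf (n + 1) L q (Function.update B m n) (m + 1) where
  card_eq := by
    rw [Finset.range_add_one, Finset.filter_insert, if_pos hq,
      Finset.card_insert_of_notMem (by simp), h.card_eq]
  mem j hj := by
    rw [Function.update_apply]
    split_ifs with hjm
    · exact ⟨Nat.lt_succ_self n, hq⟩
    · have := h.mem j (by omega)
      exact ⟨by omega, this.2⟩
  surj v hv hvq := by
    by_cases hvn : v = n
    · exact ⟨m, by omega, by simp [hvn]⟩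
    · obtain ⟨j, hj, hjv⟩ := h.surj v (by omega) hvq
      exact ⟨j, by omega, by rw [Function.update_of_ne (by omega), hjv]⟩

theorem IsListOf.skip {L B : ℕ → ℕ} {q m : ℕ} (h : IsListOf n L q B m) (hq : L n ≠ q) :
    IsListOf (n + 1) L q B m where
  card_eq := by
    rw [Finset.range_add_one, Finset.filter_insert, if_neg hq, h.card_eq]
  mem j hj := by
    have := h.mem j (by omega)
    exact ⟨by omega, this.2⟩
  surj v hv hvq := h.surj v (lt_of_le_of_ne (by omega) (by rintro rfl; exact hq hvq)) hvq

/-- List the class whose label is in register `4` in array `5`, with length in register `6`. -/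
def listClass : Prog :=
  .seq (.assign 6 (.lit 0))
    (forLoop 10 0 (.cond (.eq (.get 3 (.var 10)) (.var 4))
      (.seq (.store 5 (.var 6) (.var 10)) (.assign 6 (.add (.var 6) (.lit 1)))) .skip))

theorem run_listClass (h0 : σ.reg 0 = n) :
    Run N listClass σ (n * 21 + 8)
      fun σ' => IsListOf n (σ.mem 3) (σ.reg 4) (σ'.mem 5) (σ'.reg 6) := by
  refine Run.of_bdd fun _ hσ => ?_
  have hnN : n ≤ N := h0 ▸ hσ.1 0
  refine (Run.seq (R := fun σ' => σ' = σ.setReg 6 0)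
    (Run.assign (by decide) (fun _ => Nat.zero_le _) rfl) (t₂ := n * (13 + 8) + 6) ?_).mono
    (by simp [Expr.cost]; omega) fun _ _ _ h => h
  rintro σ₁ - rfl
  refine Run.forLoop (fun k σ' => IsListOf k (σ.mem 3) (σ.reg 4) (σ'.mem 5) (σ'.reg 6))
    (by simp [h0]) (by decide) (by decide) (by decide) ?_ ?_
  · exact ⟨by simp, by simp, by simp⟩
  intro k hk σ' hF hr hI
  have hL : σ'.mem 3 = σ.mem 3 := by rw [hF.2 3 (by decide)]; simp
  have hq : σ'.reg 4 = σ.reg 4 := by rw [hF.1 4 (by decide)]; simp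
  refine (Run.cond (t := 8) (by decide) (fun hb => ?_) fun hb => ?_).mono (by simp [Expr.cost])
    fun _ _ _ h => h
  · have hb' : σ.mem 3 k = σ.reg 4 := by simpa [Expr.eval, hL, hq, hr] using hb
    refine (Run.seq (R := fun σ'' => σ'' = σ'.setMem 5 (σ'.reg 6) k) (t₂ := 4)
      (Run.store (by decide) (by decide) (fun _ => ?_) ?_) ?_).mono (by simp [Expr.cost])
      fun _ _ _ h => h
    · simp only [Expr.eval]; omega
    · simp [Expr.eval, hr]
    · rintro σ₂ - rfl
      refine (Run.assign (by decide) (fun _ => ?_) ?_)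
      · have := hI.le
        simp only [Expr.eval, State.setMem_reg]; omega
      · simpa [Expr.eval] using hI.append hb'
  · have hb' : σ.mem 3 k ≠ σ.reg 4 := by simpa [Expr.eval, hL, hq, hr] using hb
    exact (Run.skip (by simpa using hI.skip hb')).mono (by omega) fun _ _ _ h => h

/-! ### Testing a class against the other elements -/

/-- Set register `8` to a nonzero value if the class in the list is split by the element in
register `7`. -/
def testClass : Prog :=
  sumLoop 8 10 6 (.not (.eq (.get 0 (.row (.var 7) 0 (.get 5 (.var 10))))
    (.get 0 (.row (.var 7) 0 (.get 5 (.lit 0))))))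

theorem run_testClass {L : ℕ → ℕ} {q m w : ℕ} (h0 : σ.reg 0 = n) (h7 : σ.reg 7 = w)
    (h6 : σ.reg 6 = m) (hB : IsListOf n L q (σ.mem 5) m) :
    Run N testClass σ (m * 28 + 8) fun σ' =>
      (σ'.reg 8 = 0 → ∀ x < n, ∀ y < n, L x = q → L y = q →
        σ.mem 0 (w * n + x) = σ.mem 0 (w * n + y)) ∧
      (σ'.reg 8 ≠ 0 → (σ.mem 5 0 < n ∧ L (σ.mem 5 0) = q) ∧
        ∃ v < n, L v = q ∧ σ.mem 0 (w * n + v) ≠ σ.mem 0 (w * n + σ.mem 5 0)) := by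
  refine Run.of_bdd fun _ hσ => ?_
  have hmN : m ≤ N := h6 ▸ hσ.1 6
  refine (Run.sumLoop (fun j => 1 - if σ.mem 0 (w * n + σ.mem 5 j) = σ.mem 0 (w * n + σ.mem 5 0)
    then 1 else 0) h6 (by decide) (by decide) (by decide) (by decide) ?_ ?_).mono
    (by simp [Expr.cost]) ?_
  · intro k hk σ' hF hr
    simp [Expr.eval, hr, hF.2 0 (by decide), hF.2 5 (by decide), hF.1 0 (by decide),
      hF.1 7 (by decide), h0, h7]
  · refine le_trans ((Finset.sum_le_card_nsmul _ _ 1 fun j _ => Nat.sub_le _ _).trans ?_) hmN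
    simp
  · intro σ' _ _ h8
    rw [h8]
    constructor
    · intro hsum
      rw [Finset.sum_eq_zero_iff] at hsum
      have key (v : ℕ) (hv : v < n) (hvq : L v = q) :
          σ.mem 0 (w * n + v) = σ.mem 0 (w * n + σ.mem 5 0) := by
        obtain ⟨j, hj, rfl⟩ := hB.surj v hv hvq
        by_contra hne
        have := hsum j (Finset.mem_range.2 hj)
        simp [hne] at this
      intro x hx y hy hxq hyq
      rw [key x hx hxq, key y hy hyq]
    · intro hsum
      obtain ⟨j, hj, hne⟩ := Finset.exists_ne_zero_of_sum_ne_zero hsum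
      rw [one_sub_ite_ne_zero] at hne
      have hj' := Finset.mem_range.1 hj
      exact ⟨hB.mem 0 (by omega), _, (hB.mem j hj').1, (hB.mem j hj').2, hne⟩

/-- Test the class in the list against the element in register `7` unless a splitting element has
been found already, or the test is pointless. -/
def scanStep : Prog :=
  .cond
    (.mul (.mul (.eq (.var 8) (.lit 0)) (.eq (.get 4 (.row (.var 4) 0 (.var 7))) (.lit 0)))
      (.not (.eq (.get 3 (.var 7)) (.var 4))))
    (.seq testClass
      (.cond (.var 8) (.assign 9 (.var 7)) (.store 4 (.row (.var 4) 0 (.var 7)) (.lit 1))))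
    .skip

/-- Test the class in the list against the elements outside of it until one of them splits it.
Such an element is left in register `9`, with a nonzero value in register `8`. -/
def scanClass : Prog := .seq (.assign 8 (.lit 0)) (forLoop 7 0 scanStep)

theorem run_scanClass {tab L : ℕ → ℕ} {z q c m : ℕ} (h0 : σ.reg 0 = n) (htab : σ.mem 0 = tab)
    (hL : σ.mem 3 = L) (h4 : σ.reg 4 = q) (h6 : σ.reg 6 = m)
    (hB : IsListOf n L q (σ.mem 5) m) (hR : Refinement n tab z L (σ.mem 4) q c) :
    ∃ t, Run N scanClass σ t fun σ' =>
      (Refinement n tab z L (σ'.mem 4) q c ∧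
        (σ'.reg 8 = 0 → ∀ w < n, L w ≠ q → σ'.mem 4 (q * n + w) ≠ 0) ∧
        (σ'.reg 8 ≠ 0 → (σ'.reg 9 < n ∧ L (σ'.reg 9) ≠ q) ∧ (σ.mem 5 0 < n ∧ L (σ.mem 5 0) = q) ∧
          ∃ v < n, L v = q ∧
            tab (σ'.reg 9 * n + v) ≠ tab (σ'.reg 9 * n + σ.mem 5 0))) ∧
      t + 28 * untested n L (σ'.mem 4) ≤ 28 * untested n L (σ.mem 4) + 100 * n + 8 := by
  refine (Run.forLoop_potential (N := N) (p := scanStep) (σ := σ.setReg 8 0) (r := 7)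
    (b := 0) (m := n)
    (fun k σ' => Refinement n tab z L (σ'.mem 4) q c ∧
        (σ'.reg 8 = 0 → ∀ w < k, L w ≠ q → σ'.mem 4 (q * n + w) ≠ 0) ∧
        (σ'.reg 8 ≠ 0 → (σ'.reg 9 < n ∧ L (σ'.reg 9) ≠ q) ∧ (σ.mem 5 0 < n ∧ L (σ.mem 5 0) = q) ∧
          ∃ v < n, L v = q ∧
            tab (σ'.reg 9 * n + v) ≠ tab (σ'.reg 9 * n + σ.mem 5 0)))
    -- A successful test of a class of m elements costs about 28m and lowers the first term by 28m.
    -- The single test that finds a splitter marks nothing and is paid by the reserve 28n, which is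
    -- released when register 8 becomes nonzero. The last term covers the constant cost of each
    -- iteration.
    (fun k σ' => 28 * untested n L (σ'.mem 4) + (if σ'.reg 8 = 0 then 28 * n else 0) +
      50 * (n - k)) (by simp [h0]) (by decide) (by decide) (by decide) ?_ ?_).elim fun t ht => ?_
  rotate_left 2
  · refine ⟨2 + t, .seq (R := fun σ' => σ' = σ.setReg 8 0)
      (Run.assign (by decide) (fun _ => Nat.zero_le _) rfl) ?_⟩
    rintro σ₁ - rfl
    refine ht.mono le_rfl fun σ' _ _ ⟨h1, h2⟩ => ⟨h1, ?_⟩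
    simp at h2
    omega
  · simpa using hR
  rintro k hk σ' hF hr ⟨hI1, hI2, hI3⟩
  have e0 : σ'.reg 0 = n := by rw [hF.1 0 (by decide)]; simp [h0]
  have e4 : σ'.reg 4 = q := by rw [hF.1 4 (by decide)]; simp [h4]
  have e6 : σ'.reg 6 = m := by rw [hF.1 6 (by decide)]; simp [h6]
  have eL : σ'.mem 3 = L := by rw [hF.2 3 (by decide)]; simp [hL]
  have eB : σ'.mem 5 = σ.mem 5 := by rw [hF.2 5 (by decide)]; simp
  have etab : σ'.mem 0 = tab := by rw [hF.2 0 (by decide)]; simp [htab]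
  by_cases hcase : σ'.reg 8 = 0 ∧ σ'.mem 4 (q * n + k) = 0 ∧ L k ≠ q
  · obtain ⟨h8, hU, hkq⟩ := hcase
    have hm := hB.le
    have hmark := untested_mark (L := L) hk hU
    rw [hB.card_eq] at hmark
    have hb : Expr.eval σ' (.mul (.mul (.eq (.var 8) (.lit 0))
        (.eq (.get 4 (.row (.var 4) 0 (.var 7))) (.lit 0)))
        (.not (.eq (.get 3 (.var 7)) (.var 4)))) ≠ 0 := by
      simp [Expr.eval, h8, e4, e0, hr, hU, eL, hkq]
    refine ⟨_, Run.cond (by decide) (fun _ => Run.seq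
      (run_testClass (q := q) (L := L) e0 hr e6 (eB ▸ hB)) (t₂ := 9) ?_) (fun hb' => absurd hb' hb)⟩
    rintro σ₁ hF₁ ⟨hT1, hT2⟩
    rw [etab, eB] at hT2
    rw [etab] at hT1
    have f0 : σ₁.reg 0 = n := by rw [hF₁.1 0 (by decide), e0]
    have f4 : σ₁.reg 4 = q := by rw [hF₁.1 4 (by decide), e4]
    have f7 : σ₁.reg 7 = k := by rw [hF₁.1 7 (by decide), hr]
    have fU : σ₁.mem 4 = σ'.mem 4 := hF₁.2 4 (by decide)
    refine (Run.cond (t := 7) (by decide) (fun hb => ?_) fun hb => ?_).mono (by simp [Expr.cost])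
      fun _ _ _ h => h
    · refine (Run.assign (by decide) (fun hB => hB.1 7) ?_).mono (by simp [Expr.cost])
        fun _ _ _ h => h
      simp only [Expr.eval] at hb
      simp only [Expr.eval, State.setReg_reg, State.setReg_mem, f7, fU]
      refine ⟨⟨hI1, fun h => absurd h (by simpa using hb),
        fun _ => ⟨⟨hk, hkq⟩, by simpa using hT2 hb⟩⟩, ?_⟩
      simp [Expr.cost, hb, h8]
      omega
    · refine Run.of_bdd fun hN _ => (Run.store (by decide) (by decide) (fun _ => ?_) ?_).mono
        (by simp [Expr.cost]) fun _ _ _ h => h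
      · simp only [Expr.eval]; omega
      simp only [Expr.eval] at hb
      simp only [Expr.eval, State.setReg_reg, State.setReg_mem, f7, fU, f0, f4, State.setMem_reg,
        State.setMem_mem_self]
      refine ⟨⟨hI1.mark hk hkq (hT1 hb), fun _ w hw hwq => ?_,
        fun h => absurd hb (by simpa using h)⟩, ?_⟩
      · rw [Function.update_apply]
        split_ifs with hw'
        · exact one_ne_zero
        · refine hI2 h8 w (lt_of_le_of_ne (by omega) ?_) hwq
          rintro rfl
          exact hw' rfl
      · simp [Expr.cost, hb, h8]
        omega
  · have hb : Expr.eval σ' (.mul (.mul (.eq (.var 8) (.lit 0))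
        (.eq (.get 4 (.row (.var 4) 0 (.var 7))) (.lit 0)))
        (.not (.eq (.get 3 (.var 7)) (.var 4)))) = 0 := by
      simp only [Expr.eval, e4, e0, hr, eL]
      split_ifs <;> simp_all
    refine ⟨_, Run.cond (by decide) (fun hb' => absurd hb hb') (fun _ => Run.skip ?_)⟩
    simp only [State.setReg_reg, State.setReg_mem]
    refine ⟨⟨hI1, fun h8 w hw hwq => ?_, by simpa using hI3⟩, ?_⟩
    · simp at h8
      rcases Nat.lt_succ_iff_lt_or_eq.1 hw with hlt | rfl
      · exact hI2 h8 w hlt hwq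
      · exact fun h => hcase ⟨h8, h, hwq⟩
    · simp [Expr.cost]
      omega

end RAM

/-! ### Splitting a class, and the complete refinement. -/

namespace RAM

variable {N n : ℕ} {σ : State}

/-- Move the members of the current class that the element in register `9` tells from the first one
to a new class. -/
def splitClass : Prog :=
  .seq (storeLoop 10 0 3 (.var 10) (.add (.get 3 (.var 10))
      (.mul (.mul (.eq (.get 3 (.var 10)) (.var 4))
        (.not (.eq (.get 0 (.row (.var 9) 0 (.var 10)))
          (.get 0 (.row (.var 9) 0 (.get 5 (.lit 0)))))))
        (.sub (.var 5) (.get 3 (.var 10))))))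
    (.seq (storeLoop 10 0 4 (.row (.var 5) 0 (.var 10)) (.get 4 (.row (.var 4) 0 (.var 10))))
      (.assign 5 (.add (.var 5) (.lit 1))))

theorem run_splitClass {tab L U : ℕ → ℕ} {z q c w x₀ : ℕ} (hN : n + 2 ≤ N)
    (h0 : σ.reg 0 = n) (htab : σ.mem 0 = tab)
    (hL : σ.mem 3 = L) (hU : σ.mem 4 = U) (h4 : σ.reg 4 = q) (h5 : σ.reg 5 = c) (h9 : σ.reg 9 = w)
    (hx₀ : σ.mem 5 0 = x₀) (hR : Refinement n tab z L U q c) (hq : q < c) (hw : w < n)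
    (hwq : L w ≠ q) (hx₀n : x₀ < n) (hx₀q : L x₀ = q)
    (hex : ∃ v < n, L v = q ∧ tab (w * n + v) ≠ tab (w * n + x₀)) :
    Run N splitClass σ (100 * n + 50) fun σ' =>
      Refinement n tab z (σ'.mem 3) (σ'.mem 4) q (σ'.reg 5) ∧ σ'.reg 5 = c + 1 ∧
        untested n (σ'.mem 3) (σ'.mem 4) = untested n L U := by
  have hcn := hR.le_succ
  refine (Run.seq (Run.storeLoop (m := n) (fun v => v)
    (fun v => if L v = q ∧ tab (w * n + v) ≠ tab (w * n + x₀) then c else L v)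
    h0 (by decide) (by decide) (by decide) (fun _ _ _ _ h => h) ?_ ?_)
    (t₂ := 30 * n + 20) ?_).mono (by simp [Expr.cost]; omega) fun _ _ _ h => h
  · intro v hv σ' hF hr hmem
    have hLv := hR.lt v hv
    have e3 : σ'.mem 3 v = L v := by rw [hmem v (fun l hl => hl.ne'), hL]
    refine ⟨hr, ?_⟩
    simp only [Expr.eval, hr, hF.2 0 (by decide), hF.2 5 (by decide), hF.1 0 (by decide),
      hF.1 4 (by decide), hF.1 5 (by decide), hF.1 9 (by decide), h0, h4, h5, h9, hx₀, htab, e3]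
    -- The program adds c - L v exactly for the elements that move; the truncated subtraction is
    -- exact because every label is below c.
    by_cases h1 : L v = q <;> by_cases h2 : tab (w * n + v) = tab (w * n + x₀) <;>
      simp only [h1, h2, if_true, if_false, ne_eq, not_true, not_false_eq_true, and_true,
        and_false] <;> omega
  · intro v hv _
    have hLv := hR.lt v hv
    split_ifs <;> omega
  rintro σ₁ hF₁ ⟨hL₁, -⟩
  have e4 : σ₁.reg 4 = q := by rw [hF₁.1 4 (by decide), h4]
  have e5 : σ₁.reg 5 = c := by rw [hF₁.1 5 (by decide), h5]
  have e0 : σ₁.reg 0 = n := by rw [hF₁.1 0 (by decide), h0]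
  have eU : σ₁.mem 4 = U := by rw [hF₁.2 4 (by decide), hU]
  refine (Run.seq (Run.storeLoop (m := n) (fun v => c * n + v) (fun v => U (q * n + v))
    e0 (by decide) (by decide) (by decide) (fun k _ l _ h => by omega) ?_ ?_)
    (t₂ := 4) ?_).mono (by simp [Expr.cost]; omega) fun _ _ _ h => h
  · intro v hv σ' hF hr hmem
    have e3 : σ'.mem 4 (q * n + v) = U (q * n + v) := by
      rw [hmem _ (fun l hl => ?_), eU]
      rw [Ne, rowIndex_inj hv (by omega)]
      omega
    simp only [Expr.eval, hr, hF.1 0 (by decide), hF.1 4 (by decide), hF.1 5 (by decide),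
      e0, e4, e5, e3, and_self]
  · intro v _ hB
    rw [← eU]
    exact hB.2 _ _
  rintro σ₂ hF₂ ⟨hUc, hU₂⟩
  have f5 : σ₂.reg 5 = c := by rw [hF₂.1 5 (by decide), e5]
  have f3 : σ₂.mem 3 = σ₁.mem 3 := hF₂.2 3 (by decide)
  refine Run.assign (by decide) (fun _ => ?_) ?_
  · simp only [Expr.eval, f5]
    omega
  simp only [Expr.eval, State.setReg_mem, State.setReg_reg, f5, if_true, true_and, f3]
  have hUlt (p : ℕ) (hp : p < c) (v : ℕ) (hv : v < n) :
      σ₂.mem 4 (p * n + v) = U (p * n + v) := by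
    rw [hU₂, eU]
    intro k hk
    rw [Ne, rowIndex_inj hv hk]
    omega
  -- Since the new row is a copy of row q, every element sees the same marks as before and the split
  -- leaves the potential unchanged.
  refine ⟨hR.split hq hw hwq hx₀n hx₀q hex hL₁ hUc hUlt, untested_congr fun v hv w' hw' => ?_⟩
  rw [hL₁ v hv]
  split_ifs with hcase
  · rw [hUc w' hw', hcase.1]
  · rw [hUlt _ (hR.lt v hv) w' hw']

/-! ### The refinement for one element -/

/-- Split the current class, or proceed to the next class if it is homogeneous. -/
def refineStep : Prog :=
  .seq listClass (.seq scanClass (.cond (.var 8) splitClass (.assign 4 (.add (.var 4) (.lit 1)))))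

theorem run_refineStep {tab : ℕ → ℕ} {z : ℕ} (hN : n + 2 ≤ N)
    (h0 : σ.reg 0 = n) (htab : σ.mem 0 = tab)
    (hR : Refinement n tab z (σ.mem 3) (σ.mem 4) (σ.reg 4) (σ.reg 5)) (hq : σ.reg 4 < σ.reg 5) :
    ∃ t, Run N refineStep σ t fun σ' =>
      Refinement n tab z (σ'.mem 3) (σ'.mem 4) (σ'.reg 4) (σ'.reg 5) ∧
        σ'.reg 4 + σ'.reg 5 = σ.reg 4 + σ.reg 5 + 1 ∧
        t + 28 * untested n (σ'.mem 3) (σ'.mem 4) ≤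
          28 * untested n (σ.mem 3) (σ.mem 4) + 300 * n + 100 := by
  by_cases hNσ : 2 ≤ N ∧ σ.Bdd N
  swap
  · exact ⟨0, fun hN hσ => absurd ⟨hN, hσ⟩ hNσ⟩
  obtain ⟨σ₁, t₁, he₁, ht₁, hB₁, hF₁, hl⟩ := run_listClass (N := N) h0 hNσ.1 hNσ.2
  set q := σ.reg 4 with hqdef
  set c := σ.reg 5 with hcdef
  have e0 : σ₁.reg 0 = n := by rw [hF₁.1 0 (by decide), h0]
  have e4 : σ₁.reg 4 = q := by rw [hF₁.1 4 (by decide)]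
  have e5 : σ₁.reg 5 = c := by rw [hF₁.1 5 (by decide)]
  have eL : σ₁.mem 3 = σ.mem 3 := by rw [hF₁.2 3 (by decide)]
  have eU : σ₁.mem 4 = σ.mem 4 := by rw [hF₁.2 4 (by decide)]
  have etab : σ₁.mem 0 = tab := by rw [hF₁.2 0 (by decide), htab]
  obtain ⟨s, hs⟩ := run_scanClass (N := N) (z := z) (c := c) e0 etab eL e4 rfl hl (eU ▸ hR)
  obtain ⟨σ₂, t₂, he₂, ht₂, hB₂, hF₂, ⟨hR₂, hall, hspl⟩, hle⟩ := hs hNσ.1 hB₁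
  have f0 : σ₂.reg 0 = n := by rw [hF₂.1 0 (by decide), e0]
  have f4 : σ₂.reg 4 = q := by rw [hF₂.1 4 (by decide), e4]
  have f5 : σ₂.reg 5 = c := by rw [hF₂.1 5 (by decide), e5]
  have fL : σ₂.mem 3 = σ.mem 3 := by rw [hF₂.2 3 (by decide), eL]
  have fB : σ₂.mem 5 = σ₁.mem 5 := by rw [hF₂.2 5 (by decide)]
  have ftab : σ₂.mem 0 = tab := by rw [hF₂.2 0 (by decide), etab]
  have hcn := hR.le_succ
  rw [eU] at hle
  obtain ⟨σ₃, t₃, he₃, ht₃, hB₃, hF₃, hR₃, hqc, hun⟩ : ∃ σ' t',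
      Exec (N ^ maxCost) (.cond (.var 8) splitClass (.assign 4 (.add (.var 4) (.lit 1)))) σ₂ σ' t' ∧
      t' ≤ 2 + (100 * n + 50) ∧ σ'.Bdd N ∧
      Frame (.cond (.var 8) splitClass (.assign 4 (.add (.var 4) (.lit 1)))) σ₂ σ' ∧
      (Refinement n tab z (σ'.mem 3) (σ'.mem 4) (σ'.reg 4) (σ'.reg 5) ∧
        σ'.reg 4 + σ'.reg 5 = q + c + 1 ∧
        untested n (σ'.mem 3) (σ'.mem 4) = untested n (σ.mem 3) (σ₂.mem 4)) := by
    refine Run.cond (by decide) (fun hb => ?_) (fun hb => ?_) hNσ.1 hB₂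
    · obtain ⟨⟨hw, hwq⟩, ⟨hx, hxq⟩, hex⟩ := hspl hb
      refine (run_splitClass (z := z) hN f0 ftab fL rfl f4 f5 rfl (by rw [fB]) hR₂ hq hw hwq hx hxq
        hex).mono le_rfl ?_
      rintro σ' hF - ⟨h1, h2, h3⟩
      rw [hF.1 4 (by decide), f4]
      exact ⟨h1, by omega, h3⟩
    · refine (Run.assign (by decide) (fun _ => ?_) ?_).mono (by simp [Expr.cost])
        fun _ _ _ h => h
      · simp only [Expr.eval, f4]
        omega
      · simp only [Expr.eval, State.setReg_reg, State.setReg_mem, if_true, f4, f5, fL]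
        exact ⟨hR₂.advance hq (hall hb), by simp; omega, trivial⟩
  have he := Exec.seq _ _ _ _ _ _ _ he₁ (Exec.seq _ _ _ _ _ _ _ he₂ he₃)
  exact ⟨_, fun _ _ => ⟨σ₃, _, he, le_rfl, hB₃, he.frame, hR₃, hqc, by omega⟩⟩

/-- Compute, for the element `z` in register `3`, row `z` of array `6`: the classes of the elements
other than `z` that no chain of separations separates from each other. -/
def refineFor : Prog :=
  .seq (storeLoop 10 0 3 (.var 10) (.not (.eq (.var 10) (.var 3))))
    (.seq (storeLoop 10 0 4 (.add (.var 0) (.var 10)) (.lit 0))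
      (.seq (.assign 5 (.lit 2)) (.seq (.assign 4 (.lit 1))
        (.seq (.loop (.lt (.var 4) (.var 5)) refineStep)
          (storeLoop 10 0 6 (.row (.var 3) 0 (.var 10)) (.get 3 (.var 10)))))))

theorem run_refineFor {tab : ℕ → ℕ} {z : ℕ} (hN : n + 2 ≤ N)
    (h0 : σ.reg 0 = n) (htab : σ.mem 0 = tab) (h3 : σ.reg 3 = z) (hz : z < n) :
    Run N refineFor σ (2000 * (n + 1) ^ 2) fun σ' =>
      (∀ x < n, ∀ y < n, σ'.mem 6 (z * n + x) = σ'.mem 6 (z * n + y) ↔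
        (x = z ∧ y = z) ∨ TableTogether n tab z x y) ∧
      ∀ j, (∀ v < n, j ≠ z * n + v) → σ'.mem 6 j = σ.mem 6 j := by
  refine Run.of_bdd fun hN2 _ => ?_
  refine (Run.seq (Run.storeLoop (m := n) (fun v => v) (fun v => if v = z then 0 else 1)
    h0 (by decide) (by decide) (by decide) (fun _ _ _ _ h => h) ?_ ?_)
    (t₂ := 1900 * (n + 1) ^ 2) ?_).mono (by simp [Expr.cost]; nlinarith) fun _ _ _ h => h
  · intro v hv σ' hF hr hmem
    simp only [Expr.eval, hr, hF.1 3 (by decide), h3, true_and]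
    split_ifs <;> rfl
  · intro v _ _
    split_ifs <;> omega
  rintro σ₁ hF₁ ⟨hL₁, -⟩
  have e0 : σ₁.reg 0 = n := by rw [hF₁.1 0 (by decide), h0]
  have e3 : σ₁.reg 3 = z := by rw [hF₁.1 3 (by decide), h3]
  have etab : σ₁.mem 0 = tab := by rw [hF₁.2 0 (by decide), htab]
  have eP : σ₁.mem 6 = σ.mem 6 := by rw [hF₁.2 6 (by decide)]
  -- Only row 1 of the marks needs clearing: class 0 is {z} and is never processed, and later rows
  -- are overwritten when their class is created. Marks from previous values of z are therefore
  -- harmless, and no quadratic reset is needed.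
  refine (Run.seq (Run.storeLoop (m := n) (fun v => n + v) (fun v => 0)
    e0 (by decide) (by decide) (by decide) (fun _ _ _ _ h => by omega) ?_ (fun _ _ _ => by omega))
    (t₂ := 1800 * (n + 1) ^ 2) ?_).mono (by simp [Expr.cost]; nlinarith) fun _ _ _ h => h
  · intro v hv σ' hF hr hmem
    simp only [Expr.eval, hr, hF.1 0 (by decide), e0, and_self]
  rintro σ₂ hF₂ ⟨hU₂, -⟩
  refine (Run.seq (R := fun σ' => σ' = σ₂.setReg 5 2) (t₂ := 1750 * (n + 1) ^ 2)
    (Run.assign (by decide) (fun _ => by simpa [Expr.eval] using hN2) rfl) ?_).mono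
    (by simp [Expr.cost]; nlinarith) fun _ _ _ h => h
  rintro σ₃ - rfl
  refine (Run.seq (R := fun σ' => σ' = (σ₂.setReg 5 2).setReg 4 1) (t₂ := 1700 * (n + 1) ^ 2)
    (Run.assign (by decide) (fun _ => by simp [Expr.eval]; omega) rfl) ?_).mono
    (by simp [Expr.cost]; nlinarith) fun _ _ _ h => h
  rintro σ₄ - rfl
  set σ₄ := (σ₂.setReg 5 2).setReg 4 1 with hσ₄
  have f0 : σ₄.reg 0 = n := by simp [hσ₄, hF₂.1 0 (by decide), e0]
  have f3 : σ₄.reg 3 = z := by simp [hσ₄, hF₂.1 3 (by decide), e3]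
  have ftab : σ₄.mem 0 = tab := by simp [hσ₄, hF₂.2 0 (by decide), etab]
  have fP : σ₄.mem 6 = σ.mem 6 := by simp [hσ₄, hF₂.2 6 (by decide), eP]
  have hR₄ : Refinement n tab z (σ₄.mem 3) (σ₄.mem 4) (σ₄.reg 4) (σ₄.reg 5) := by
    simp only [hσ₄, State.setReg_reg, State.setReg_mem]
    exact Refinement.init hz (fun v hv => by rw [hF₂.2 3 (by decide), hL₁ v hv]) hU₂
  have hs₄ : σ₄.reg 4 + σ₄.reg 5 = 3 := by simp [hσ₄]
  clear_value σ₄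
  have hloop : Run N (.loop (.lt (.var 4) (.var 5)) refineStep) σ₄ (1500 * (n + 1) ^ 2) fun σ' =>
      Refinement n tab z (σ'.mem 3) (σ'.mem 4) (σ'.reg 4) (σ'.reg 5) ∧ σ'.reg 4 = σ'.reg 5 := by
    refine Run.of_exists ((Run.loop (N := N)
      (fun σ' => Refinement n tab z (σ'.mem 3) (σ'.mem 4) (σ'.reg 4) (σ'.reg 5))
      -- Every round raises q + c by one, by finishing a class or creating one. As q < c ≤ n + 1
      -- before a round, q + c never exceeds 2n + 2.
      (fun σ' => 28 * untested n (σ'.mem 3) (σ'.mem 4) +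
        (300 * n + 110) * (2 * n + 2 - (σ'.reg 4 + σ'.reg 5))) (by decide) hR₄ ?_).imp
      fun t ht => ht.mono le_rfl ?_)
    · intro σ' hF hR hb
      have hlt : σ'.reg 4 < σ'.reg 5 := by
        by_contra hlt
        simp [Expr.eval, hlt] at hb
      obtain ⟨t, ht⟩ := run_refineStep hN (by rw [hF.1 0 (by decide), f0])
        (by rw [hF.2 0 (by decide), ftab]) hR hlt
      refine ⟨t, ht.mono le_rfl fun σ'' _ _ ⟨h1, h2, h3⟩ => ⟨h1, ?_⟩⟩
      have hcn := hR.le_succ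
      obtain ⟨d, hd⟩ : ∃ d, 2 * n + 2 - (σ'.reg 4 + σ'.reg 5) = d + 1 :=
        ⟨2 * n + 2 - (σ'.reg 4 + σ'.reg 5) - 1, by omega⟩
      rw [show 2 * n + 2 - (σ''.reg 4 + σ''.reg 5) = d by omega, hd, mul_add]
      simp only [Expr.cost]
      omega
    · rintro σ' hF - ⟨⟨hR, hb⟩, hle⟩
      refine ⟨⟨hR, ?_⟩, ?_⟩
      · have hlt : ¬ σ'.reg 4 < σ'.reg 5 := fun hlt => by simp [Expr.eval, hlt] at hb
        have := hR.le
        omega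
      · have h1 := untested_le n (σ₄.mem 3) (σ₄.mem 4)
        rw [hs₄] at hle
        have h2 : (300 * n + 110) * (2 * n + 2 - 3) ≤ (300 * n + 110) * (2 * n) :=
          Nat.mul_le_mul_left _ (by omega)
        simp only [Expr.cost] at hle
        nlinarith
  refine (hloop.seq (t₂ := 100 * (n + 1)) ?_).mono (by nlinarith) fun _ _ _ h => h
  rintro σ₅ hF₅ ⟨hR, hqc⟩
  refine (Run.storeLoop (m := n) (fun v => z * n + v) (fun v => σ₅.mem 3 v)
    (by rw [hF₅.1 0 (by decide), f0]) (by decide) (by decide) (by decide)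
    (fun _ _ _ _ h => by omega) ?_ (fun v _ hB => hB.2 _ _)).mono (by simp [Expr.cost]; omega) ?_
  · intro v hv σ' hF hr hmem
    simp only [Expr.eval, hr, hF.1 0 (by decide), hF.1 3 (by decide), hF.2 3 (by decide),
      hF₅.1 0 (by decide), hF₅.1 3 (by decide), f0, f3, and_self]
  · rintro σ' - - ⟨h1, h2⟩
    refine ⟨fun x hx y hy => ?_, fun j hj => ?_⟩
    · rw [h1 x hx, h1 y hy]
      exact hR.eq_iff hqc hx hy
    · rw [h2 j hj, hF₅.2 6 (by decide), fP]

/-- Compute the rows of array `6` for all elements. -/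
def refineAll : Prog := forLoop 3 0 refineFor

theorem run_refineAll {tab : ℕ → ℕ} (hN : n + 2 ≤ N) (h0 : σ.reg 0 = n) (htab : σ.mem 0 = tab) :
    Run N refineAll σ (2020 * (n + 1) ^ 3) fun σ' =>
      ∀ z < n, ∀ x < n, ∀ y < n, σ'.mem 6 (z * n + x) = σ'.mem 6 (z * n + y) ↔
        (x = z ∧ y = z) ∨ TableTogether n tab z x y := by
  refine (Run.forLoop (m := n) (T := 2000 * (n + 1) ^ 2) (p := refineFor)
    (fun k σ' => ∀ z < k, ∀ x < n, ∀ y < n, σ'.mem 6 (z * n + x) = σ'.mem 6 (z * n + y) ↔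
      (x = z ∧ y = z) ∨ TableTogether n tab z x y) h0 (by decide) (by decide) (by decide)
    (fun z hz => absurd hz (Nat.not_lt_zero z)) ?_).mono (by ring_nf; omega) fun _ _ _ h => h
  intro k hk σ' hF hr hI
  refine (run_refineFor (tab := tab) hN (by rw [hF.1 0 (by decide), h0])
    (by rw [hF.2 0 (by decide), htab])
    hr hk).mono le_rfl fun σ'' _ _ ⟨h1, h2⟩ z hz x hx y hy => ?_
  rcases Nat.lt_succ_iff_lt_or_eq.1 hz with hlt | rfl
  · simp only [State.setReg_mem]
    rw [h2, h2]
    · exact hI z hlt x hx y hy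
    -- The rows written for smaller z are disjoint from the row written now.
    all_goals
      intro v hv
      rw [Ne, rowIndex_inj (by assumption) hv]
      omega
  · exact h1 x hx y hy

end RAM

namespace RAM

variable {N n : ℕ} {σ : State}

/-! ### Filling tables -/

/-- Store the values that `p` leaves in register `8` in the table `a`, for all positions. -/
def tableLoop (a : ℕ) (p : Prog) : Prog :=
  forLoop 12 0 (forLoop 13 0 (.seq p (.store a (.row (.var 12) 0 (.var 13)) (.var 8))))

/-- A relation `G` is used instead of a function so that minima can be specified by their thresholds
alone. -/
theorem run_tableLoop {a T : ℕ} {p : Prog} (G : ℕ → ℕ → ℕ → Prop) (h0 : σ.reg 0 = n)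
    (hp0 : 0 ∉ p.regs) (hp12 : 12 ∉ p.regs) (hp13 : 13 ∉ p.regs) (ha : a ∉ p.arrs)
    (hp : ∀ x < n, ∀ y < n, ∀ σ', Frame (tableLoop a p) σ σ' → σ'.reg 12 = x → σ'.reg 13 = y →
      Run N p σ' T fun σ'' => G x y (σ''.reg 8)) :
    Run N (tableLoop a p) σ (n * (n * (T + 15) + 14) + 6)
      fun σ' => ∀ x < n, ∀ y < n, G x y (σ'.mem a (x * n + y)) := by
  have hsub : Prog.regs (.seq p (.store a (.row (.var 12) 0 (.var 13)) (.var 8))) = p.regs := by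
    simp [Prog.regs]
  have hregs : Prog.regs (forLoop 13 0 (.seq p (.store a (.row (.var 12) 0 (.var 13)) (.var 8)))) =
      13 :: (p.regs ++ [13]) := by simp [forLoop, Prog.regs]
  refine Run.forLoop (T := n * (T + 7 + 8) + 6)
    (fun k σ' => ∀ x < k, ∀ y < n, G x y (σ'.mem a (x * n + y))) h0
    (by simp [hregs, hp12]) (by simp [hregs, hp0]) (by decide)
    (fun _ h => absurd h (Nat.not_lt_zero _)) ?_
  intro x hx σ₁ hF₁ hr₁ hI
  have e0 : σ₁.reg 0 = n := by rw [hF₁.1 0 (by simp [forLoop, Prog.regs, hp0]), h0]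
  refine (Run.forLoop (T := T + 7)
    (fun k σ' => (∀ x' < x, ∀ y < n, G x' y (σ'.mem a (x' * n + y))) ∧
      ∀ y < k, G x y (σ'.mem a (x * n + y))) e0 (by simp [hsub, hp13]) (by simp [hsub, hp0])
    (by decide) ⟨hI, fun _ h => absurd h (Nat.not_lt_zero _)⟩ ?_).mono le_rfl ?_
  swap
  · rintro σ' - - ⟨h1, h2⟩ x' hx' y hy
    rcases Nat.lt_succ_iff_lt_or_eq.1 hx' with hlt | rfl
    exacts [h1 x' hlt y hy, h2 y hy]
  rintro y hy σ₂ hF₂ hr₂ ⟨hI1, hI2⟩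
  have e12 : σ₂.reg 12 = x := by rw [hF₂.1 12 (by simp [hregs, hp12]), hr₁]
  have f0 : σ₂.reg 0 = n := by rw [hF₂.1 0 (by simp [hregs, hp0]), e0]
  have hF : Frame (tableLoop a p) σ σ₂ := hF₁.trans (hF₂.mono
    (by intro r; simp [forLoop, Prog.regs]; tauto) (by simp [forLoop, Prog.arrs]))
  refine (hp x hx y hy σ₂ hF e12 hr₂).seq fun σ₃ hF₃ hG => Run.mono (Run.store (by decide)
    (by decide) (fun hB => hB.1 8) ?_) (by simp [Expr.cost]) fun _ _ _ h => h
  simp only [Expr.eval, hF₃.1 12 hp12, hF₃.1 13 hp13, hF₃.1 0 hp0, e12, hr₂, f0,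
    State.setReg_mem, State.setMem_mem_self, hF₃.2 a ha, Function.update_apply]
  refine ⟨fun x' hx' y' hy' => ?_, fun y' hy' => ?_⟩
  · rw [if_neg (by rw [rowIndex_inj hy' hy]; omega)]
    exact hI1 x' hx' y' hy'
  · split_ifs with h
    · rw [(rowIndex_inj (by omega) hy).1 h |>.2]
      exact hG
    · exact hI2 y' (lt_of_le_of_ne (by omega) (by rintro rfl; exact h rfl))

theorem sum_not_ite (s : Finset ℕ) (p : ℕ → Prop) [DecidablePred p] :
    ∑ z ∈ s, (1 - if p z then 1 else 0) = (s.filter fun z => ¬ p z).card := by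
  rw [Finset.card_filter]
  refine Finset.sum_congr rfl fun z _ => ?_
  by_cases h : p z <;> simp [h]

/-- Count in array `7`, for all `x` and `y`, the rows of array `6` that tell `x` from `y`. -/
def countAll : Prog :=
  tableLoop 7 (sumLoop 8 10 0 (.not (.eq (.get 6 (.row (.var 10) 0 (.var 12)))
    (.get 6 (.row (.var 10) 0 (.var 13))))))

theorem run_countAll {P : ℕ → ℕ} (h0 : σ.reg 0 = n) (hP : σ.mem 6 = P) :
    Run N countAll σ (100 * (n + 1) ^ 3) fun σ' => ∀ x < n, ∀ y < n,
      σ'.mem 7 (x * n + y) =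
        ((Finset.range n).filter fun z => ¬ P (z * n + x) = P (z * n + y)).card := by
  refine Run.of_bdd fun _ hσ => ?_
  have hnN : n ≤ N := h0 ▸ hσ.1 0
  refine (run_tableLoop (T := n * 26 + 8) (fun x y v => v =
    ((Finset.range n).filter fun z => ¬ P (z * n + x) = P (z * n + y)).card) h0 (by decide)
    (by decide) (by decide) (by decide) ?_).mono (by ring_nf; omega) fun _ _ _ h => h
  intro x _ y _ σ' hF hx hy
  rw [← sum_not_ite]
  refine (Run.sumLoop _ (by rw [hF.1 0 (by decide), h0]) (by decide) (by decide) (by decide)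
    (by decide) ?_ ?_).mono (by simp [Expr.cost]) fun _ _ _ h => h
  · intro k hk σ₁ hF₁ hr
    simp only [Expr.eval, hr, hF₁.1 0 (by decide), hF₁.1 12 (by decide), hF₁.1 13 (by decide),
      hF₁.2 6 (by decide), hx, hy, hF.1 0 (by decide), hF.2 6 (by decide), h0, hP]
  · rw [sum_not_ite]
    exact (Finset.card_filter_le _ _).trans (by simpa)

/-- Row `z` identifies `x` and `y`, or row `x` identifies `y` and `z`. -/
def Incomparable (n : ℕ) (P : ℕ → ℕ) (x y z : ℕ) : Prop :=
  P (z * n + x) = P (z * n + y) ∨ P (x * n + z) = P (x * n + y)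

/-- Compute in array `8`, for all `x` and `y`, the smallest entry `z` in row `x` of array `7` among
the `z` that are incomparable to `y`. -/
def minAll : Prog :=
  tableLoop 8 (.seq (.assign 8 (.add (.var 0) (.lit 1)))
    (forLoop 10 0 (.cond
      (.mul (.add
          (.eq (.get 6 (.row (.var 10) 0 (.var 12))) (.get 6 (.row (.var 10) 0 (.var 13))))
          (.eq (.get 6 (.row (.var 12) 0 (.var 10))) (.get 6 (.row (.var 12) 0 (.var 13)))))
        (.lt (.get 7 (.row (.var 12) 0 (.var 10))) (.var 8)))
      (.assign 8 (.get 7 (.row (.var 12) 0 (.var 10)))) .skip)))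

theorem run_minAll {P C : ℕ → ℕ} (hN : n + 2 ≤ N) (h0 : σ.reg 0 = n) (hP : σ.mem 6 = P)
    (hC : σ.mem 7 = C) :
    Run N minAll σ (100 * (n + 1) ^ 3) fun σ' => ∀ x < n, ∀ y < n, ∀ s ≤ n,
      σ'.mem 8 (x * n + y) ≤ s ↔ ∃ z < n, Incomparable n P x y z ∧ C (x * n + z) ≤ s := by
  refine (run_tableLoop (T := n * 60 + 10)
    (fun x y v => ∀ s ≤ n, v ≤ s ↔ ∃ z < n, Incomparable n P x y z ∧ C (x * n + z) ≤ s)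
    h0 (by decide) (by decide) (by decide) (by decide) ?_).mono (by ring_nf; omega) fun _ _ _ h => h
  intro x _ y _ σ' hF hx hy
  have e0 : σ'.reg 0 = n := by rw [hF.1 0 (by decide), h0]
  have eP : σ'.mem 6 = P := by rw [hF.2 6 (by decide), hP]
  have eC : σ'.mem 7 = C := by rw [hF.2 7 (by decide), hC]
  -- The value n + 1 plays the role of infinity, since only thresholds s ≤ n are compared.
  refine (Run.seq (R := fun σ₁ => σ₁ = σ'.setReg 8 (n + 1)) (t₂ := n * (52 + 8) + 6)
    (Run.assign (by decide) (fun _ => by simp only [Expr.eval, e0]; omega)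
      (by simp [Expr.eval, e0])) ?_).mono (by simp [Expr.cost]; omega) fun _ _ _ h => h
  rintro σ₁ - rfl
  refine Run.forLoop (T := 52) (fun k σ₂ => ∀ s ≤ n, σ₂.reg 8 ≤ s ↔
    ∃ z < k, Incomparable n P x y z ∧ C (x * n + z) ≤ s) (by simp [e0]) (by decide) (by decide)
    (by decide) ?_ ?_
  · intro s hs
    simp
    omega
  intro z hz σ₂ hF₂ hr hI
  have f0 : σ₂.reg 0 = n := by rw [hF₂.1 0 (by decide)]; simp [e0]
  have f12 : σ₂.reg 12 = x := by rw [hF₂.1 12 (by decide)]; simp [hx]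
  have f13 : σ₂.reg 13 = y := by rw [hF₂.1 13 (by decide)]; simp [hy]
  have fP : σ₂.mem 6 = P := by rw [hF₂.2 6 (by decide)]; simp [eP]
  have fC : σ₂.mem 7 = C := by rw [hF₂.2 7 (by decide)]; simp [eC]
  have hsucc (s : ℕ) : (∃ z' < z + 1, Incomparable n P x y z' ∧ C (x * n + z') ≤ s) ↔
      (∃ z' < z, Incomparable n P x y z' ∧ C (x * n + z') ≤ s) ∨
        (Incomparable n P x y z ∧ C (x * n + z) ≤ s) := by
    constructor
    · rintro ⟨z', hz', h⟩
      rcases Nat.lt_succ_iff_lt_or_eq.1 hz' with hlt | rfl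
      exacts [.inl ⟨z', hlt, h⟩, .inr h]
    · rintro (⟨z', hz', h⟩ | h)
      exacts [⟨z', by omega, h⟩, ⟨z, by omega, h⟩]
  refine (Run.cond (t := 10) (by decide) (fun hb => ?_) (fun hb => ?_)).mono (by simp [Expr.cost])
    fun _ _ _ h => h
  · refine (Run.assign (by decide) (fun hB => hB.2 _ _) ?_).mono (by simp [Expr.cost])
      fun _ _ _ h => h
    simp only [Expr.eval, hr, f0, f12, f13, fP, fC] at hb
    intro s hs
    rw [hsucc, ← hI s hs]
    simp only [Expr.eval, hr, f0, f12, fC, State.setReg_reg, if_true, if_false,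
      show (8 : ℕ) ≠ 10 by decide]
    rw [mul_ne_zero_iff] at hb
    have h1 : Incomparable n P x y z := by
      by_contra h
      rw [Incomparable, not_or] at h
      simp [h.1, h.2] at hb
    have h2 : C (x * n + z) < σ₂.reg 8 := by
      by_contra h
      simp [h] at hb
    simp only [h1, true_and]
    omega
  · refine (Run.skip ?_).mono (by omega) fun _ _ _ h => h
    simp only [Expr.eval, hr, f0, f12, f13, fP, fC] at hb
    intro s hs
    rw [hsucc, ← hI s hs]
    simp only [State.setReg_reg, if_false, show (8 : ℕ) ≠ 10 by decide]
    have h2 : Incomparable n P x y z → σ₂.reg 8 ≤ C (x * n + z) := by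
      intro h1
      by_contra h
      rw [not_le] at h
      rcases h1 with h1 | h1 <;> simp [h1, h] at hb
    constructor
    · exact .inl
    · rintro (h | ⟨h, h'⟩)
      exacts [h, (h2 h).trans h']

end RAM

namespace RAM

variable {N n : ℕ} {σ : State}

/-! ### Listing the strong sets -/

/-- The test, for the position `(x, s)`, that is read off from the tables `C` and `Q`. -/
def Good (n : ℕ) (C Q : ℕ → ℕ) (x s : ℕ) : Prop :=
  ((Finset.range n).filter fun z => C (x * n + z) ≤ s).card = s ∧
    ∀ y < n, Q (x * n + y) ≤ s → C (x * n + y) ≤ s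

/-- A list of `k` sets, with a representative and the size of each set, such that entry `(v, s)` of
`idx` is the successor of the index of the listed set of size `s` that contains `v`. -/
structure Listing (n : ℕ) (C Q out idx rep size : ℕ → ℕ) (k : ℕ) : Prop where
  good : ∀ i < k, rep i < n ∧ size i ≤ n ∧ Good n C Q (rep i) (size i)
  out_iff : ∀ i < k, ∀ v < n, out (i * n + v) ≠ 0 ↔ C (rep i * n + v) ≤ size i
  idx_mem : ∀ v < n, ∀ s ≤ n, idx (v * (n + 1) + s) ≠ 0 →
    ∃ i < k, idx (v * (n + 1) + s) = i + 1 ∧ size i = s ∧ C (rep i * n + v) ≤ s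
  mem_idx : ∀ i < k, ∀ v < n, C (rep i * n + v) ≤ size i → idx (v * (n + 1) + size i) = i + 1

/-- Every element of a ball that passes the test is a center of it. -/
structure Recentering (n : ℕ) (C Q : ℕ → ℕ) : Prop where
  self : ∀ x < n, C (x * n + x) = 0
  recenter : ∀ x < n, ∀ s ≤ n, Good n C Q x s → ∀ v < n, C (x * n + v) ≤ s →
    Good n C Q v s ∧ ∀ w < n, C (v * n + w) ≤ s ↔ C (x * n + w) ≤ s

/-- The entries of size s that the new set claims must not belong to an older set. By recentering,
two listed sets of the same size that meet coincide, so it is enough to inspect the single entry (x,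
s). -/
theorem Listing.add {C Q out idx rep size out' idx' : ℕ → ℕ} {k x s : ℕ}
    (hrec : Recentering n C Q) (h : Listing n C Q out idx rep size k) (hx : x < n) (hs : s ≤ n)
    (hgood : Good n C Q x s) (hidx : idx (x * (n + 1) + s) = 0)
    (hout : ∀ v < n, out' (k * n + v) = 1 - if s < C (x * n + v) then 1 else 0)
    (hout' : ∀ i < k, ∀ v < n, out' (i * n + v) = out (i * n + v))
    (hidxs : ∀ v < n, idx' (v * (n + 1) + s) =
      if C (x * n + v) ≤ s then k + 1 else idx (v * (n + 1) + s))
    (hidx' : ∀ v < n, ∀ s' ≤ n, s' ≠ s → idx' (v * (n + 1) + s') = idx (v * (n + 1) + s')) :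
    Listing n C Q out' idx' (Function.update rep k x) (Function.update size k s) (k + 1) where
  good i hi := by
    rcases Nat.lt_succ_iff_lt_or_eq.1 hi with hlt | rfl
    · rw [Function.update_of_ne hlt.ne, Function.update_of_ne hlt.ne]
      exact h.good i hlt
    · simpa using ⟨hx, hs, hgood⟩
  out_iff i hi v hv := by
    rcases Nat.lt_succ_iff_lt_or_eq.1 hi with hlt | rfl
    · rw [Function.update_of_ne hlt.ne, Function.update_of_ne hlt.ne, hout' i hlt v hv]
      exact h.out_iff i hlt v hv
    · rw [hout v hv, one_sub_ite_ne_zero]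
      simp
  idx_mem v hv s' hs' hne := by
    have old (hne' : idx (v * (n + 1) + s') ≠ 0)
        (heq : idx' (v * (n + 1) + s') = idx (v * (n + 1) + s')) : ∃ i < k + 1,
        idx' (v * (n + 1) + s') = i + 1 ∧ Function.update size k s i = s' ∧
          C (Function.update rep k x i * n + v) ≤ s' := by
      obtain ⟨i, hi, h1, h2, h3⟩ := h.idx_mem v hv s' hs' hne'
      refine ⟨i, by omega, by rw [heq, h1], ?_⟩
      rw [Function.update_of_ne hi.ne, Function.update_of_ne hi.ne]
      exact ⟨h2, h3⟩
    by_cases hss : s' = s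
    · subst hss
      by_cases hC : C (x * n + v) ≤ s'
      · exact ⟨k, by omega, by rw [hidxs v hv, if_pos hC], by simp, by simpa⟩
      · have heq := hidxs v hv
        rw [if_neg hC] at heq
        exact old (heq ▸ hne) heq
    · have heq := hidx' v hv s' hs' hss
      exact old (heq ▸ hne) heq
  mem_idx i hi v hv hC := by
    rcases Nat.lt_succ_iff_lt_or_eq.1 hi with hlt | rfl
    · rw [Function.update_of_ne hlt.ne] at hC ⊢
      rw [Function.update_of_ne hlt.ne] at hC
      have hold := h.mem_idx i hlt v hv hC
      obtain ⟨hr, hsz, hg⟩ := h.good i hlt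
      by_cases hss : size i = s
      · rw [hss, hidxs v hv, if_neg, ← hss, hold]
        intro hCx
        -- If v is in both the new set and an old set i of size s, recentering both at v puts x in
        -- set i, so the entry (x, s) would already be nonzero.
        have h1 := (hrec.recenter x hx s hs hgood v hv hCx).2 x hx
        rw [hrec.self x hx] at h1
        have h2 := (hrec.recenter (rep i) hr (size i) hsz hg v hv hC).2 x hx
        rw [hss] at h2
        have h3 := h.mem_idx i hlt x hx (by rw [hss]; exact h2.1 (h1.2 (Nat.zero_le _)))
        rw [hss, hidx] at h3
        omega
      · rw [hidx' v hv _ hsz hss, hold]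
    · simp only [Function.update_self] at hC ⊢
      rw [hidxs v hv, if_pos hC]

/-- Append the set at the position in registers `12` and `14` to the list. -/
def emit : Prog :=
  .seq (storeLoop 10 0 1 (.row (.var 1) 0 (.var 10))
      (.not (.lt (.var 14) (.get 7 (.row (.var 12) 0 (.var 10))))))
    (.seq (storeLoop 10 0 9 (.row (.var 10) 2 (.var 14))
        (.add (.mul (.lt (.var 14) (.get 7 (.row (.var 12) 0 (.var 10))))
            (.get 9 (.row (.var 10) 2 (.var 14))))
          (.mul (.not (.lt (.var 14) (.get 7 (.row (.var 12) 0 (.var 10)))))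
            (.add (.var 1) (.lit 1)))))
      (.seq (.store 10 (.var 1) (.var 12))
        (.seq (.store 11 (.var 1) (.var 14)) (.assign 1 (.add (.var 1) (.lit 1))))))

/-- The list in memory. -/
def ListingState (n : ℕ) (C Q : ℕ → ℕ) (σ : State) : Prop :=
  Listing n C Q (σ.mem 1) (σ.mem 9) (σ.mem 10) (σ.mem 11) (σ.reg 1)

theorem run_emit {C Q : ℕ → ℕ} {x s : ℕ} (hrec : Recentering n C Q) (hN : σ.reg 1 + 1 ≤ N)
    (h0 : σ.reg 0 = n) (h2 : σ.reg 2 = n + 1) (h12 : σ.reg 12 = x) (h14 : σ.reg 14 = s)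
    (hC : σ.mem 7 = C) (hL : ListingState n C Q σ) (hx : x < n) (hs : s ≤ n)
    (hgood : Good n C Q x s) (hidx : σ.mem 9 (x * (n + 1) + s) = 0) :
    Run N emit σ (100 * n + 40) fun σ' => ListingState n C Q σ' ∧ σ'.reg 1 = σ.reg 1 + 1 ∧
      σ'.mem 9 (x * (n + 1) + s) ≠ 0 ∧
      ∀ v < n, ∀ s' ≤ n, σ.mem 9 (v * (n + 1) + s') ≠ 0 → σ'.mem 9 (v * (n + 1) + s') ≠ 0 := by
  refine Run.of_bdd fun hN2 hσ => ?_
  set k := σ.reg 1 with hk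
  refine (Run.seq (Run.storeLoop (m := n) (fun v => k * n + v)
    (fun v => 1 - if s < C (x * n + v) then 1 else 0) h0 (by decide) (by decide) (by decide)
    (fun _ _ _ _ h => by omega) ?_ (fun v _ _ => (Nat.sub_le _ _).trans (by omega)))
    (t₂ := 60 * n + 30) ?_).mono (by simp [Expr.cost]; omega) fun _ _ _ h => h
  · intro v hv σ' hF hr _
    simp only [Expr.eval, hr, hF.1 0 (by decide), hF.1 1 (by decide), hF.1 12 (by decide),
      hF.1 14 (by decide), hF.2 7 (by decide), h0, h12, h14, hC, ← hk, and_self]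
  rintro σ₁ hF₁ ⟨hout, hout'⟩
  have e0 : σ₁.reg 0 = n := by rw [hF₁.1 0 (by decide), h0]
  have e1 : σ₁.reg 1 = k := by rw [hF₁.1 1 (by decide)]
  have e2 : σ₁.reg 2 = n + 1 := by rw [hF₁.1 2 (by decide), h2]
  have e12 : σ₁.reg 12 = x := by rw [hF₁.1 12 (by decide), h12]
  have e14 : σ₁.reg 14 = s := by rw [hF₁.1 14 (by decide), h14]
  have eC : σ₁.mem 7 = C := by rw [hF₁.2 7 (by decide), hC]
  have e9 : σ₁.mem 9 = σ.mem 9 := by rw [hF₁.2 9 (by decide)]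
  have e10 : σ₁.mem 10 = σ.mem 10 := by rw [hF₁.2 10 (by decide)]
  have e11 : σ₁.mem 11 = σ.mem 11 := by rw [hF₁.2 11 (by decide)]
  refine (Run.seq (Run.storeLoop (m := n) (fun v => v * (n + 1) + s)
    (fun v => if C (x * n + v) ≤ s then k + 1 else σ.mem 9 (v * (n + 1) + s)) e0 (by decide)
    (by decide) (by decide)
    (fun v _ l _ h => ((rowIndex_inj (by omega) (by omega)).1 h).1) ?_ (fun v _ hB => ?_))
    (t₂ := 10) ?_).mono (by simp [Expr.cost]; omega) fun _ _ _ h => h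
  · intro v hv σ' hF hr hmem
    have e : σ'.mem 9 (v * (n + 1) + s) = σ.mem 9 (v * (n + 1) + s) := by
      rw [hmem _ (fun l hl => ?_), e9]
      rw [Ne, rowIndex_inj (by omega) (by omega)]
      omega
    simp only [Expr.eval, hr, hF.1 0 (by decide), hF.1 1 (by decide), hF.1 2 (by decide),
      hF.1 12 (by decide), hF.1 14 (by decide), hF.2 7 (by decide), e0, e1, e2, e12, e14, eC, e,
      true_and]
    by_cases hle : C (x * n + v) ≤ s
    · simp [hle, not_lt.2 hle]
    · simp [hle, not_le.1 hle]
  · split_ifs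
    · exact hN
    · exact hσ.2 _ _
  rintro σ₂ hF₂ ⟨hidxs, hidx'⟩
  have f1 : σ₂.reg 1 = k := by rw [hF₂.1 1 (by decide), e1]
  have f12 : σ₂.reg 12 = x := by rw [hF₂.1 12 (by decide), e12]
  have f14 : σ₂.reg 14 = s := by rw [hF₂.1 14 (by decide), e14]
  have fout : σ₂.mem 1 = σ₁.mem 1 := by rw [hF₂.2 1 (by decide)]
  have f10 : σ₂.mem 10 = σ.mem 10 := by rw [hF₂.2 10 (by decide), e10]
  have f11 : σ₂.mem 11 = σ.mem 11 := by rw [hF₂.2 11 (by decide), e11]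
  refine (Run.seq (R := fun σ' => σ' = σ₂.setMem 10 k x) (t₂ := 7)
    (Run.store (by decide) (by decide) (fun hB => hB.1 12) (by simp [Expr.eval, f1, f12])) ?_).mono
    (by simp [Expr.cost]) fun _ _ _ h => h
  rintro σ₃ - rfl
  refine (Run.seq (R := fun σ' => σ' = (σ₂.setMem 10 k x).setMem 11 k s) (t₂ := 4)
    (Run.store (by decide) (by decide) (fun hB => hB.1 14) (by simp [Expr.eval, f1, f14])) ?_).mono
    (by simp [Expr.cost]) fun _ _ _ h => h
  rintro σ₄ - rfl
  refine Run.assign (by decide) (fun _ => by simpa [Expr.eval, f1] using hN) ?_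
  have hidx'' : ∀ v < n, ∀ s' ≤ n, s' ≠ s →
      σ₂.mem 9 (v * (n + 1) + s') = σ.mem 9 (v * (n + 1) + s') := by
    intro v hv s' hs' hne
    rw [hidx' _ fun l hl => ?_, e9]
    rw [Ne, rowIndex_inj (by omega) (by omega)]
    omega
  have hadd := Listing.add (out' := σ₁.mem 1) (idx' := σ₂.mem 9) hrec hL hx hs hgood hidx hout
    (fun i hi v hv => hout' _ fun l hl => by
      rw [Ne, rowIndex_inj hv hl]; exact fun h => hi.ne h.1) hidxs hidx''
  have m1 : (((σ₂.setMem 10 k x).setMem 11 k s)).mem 1 = σ₁.mem 1 := by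
    rw [State.setMem_mem_of_ne _ _ _ (by decide), State.setMem_mem_of_ne _ _ _ (by decide), fout]
  have m9 : (((σ₂.setMem 10 k x).setMem 11 k s)).mem 9 = σ₂.mem 9 := by
    rw [State.setMem_mem_of_ne _ _ _ (by decide), State.setMem_mem_of_ne _ _ _ (by decide)]
  have m10 : (((σ₂.setMem 10 k x).setMem 11 k s)).mem 10 = Function.update (σ.mem 10) k x := by
    rw [State.setMem_mem_of_ne _ _ _ (by decide), State.setMem_mem_self, f10]
  have m11 : (((σ₂.setMem 10 k x).setMem 11 k s)).mem 11 = Function.update (σ.mem 11) k s := by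
    rw [State.setMem_mem_self, State.setMem_mem_of_ne _ _ _ (by decide), f11]
  simp only [ListingState, Expr.eval, State.setReg_mem, State.setReg_reg, State.setMem_reg, f1,
    if_true, m1, m9, m10, m11, true_and]
  refine ⟨hadd, ?_, fun v hv s' hs' hne => ?_⟩
  · rw [hidxs x hx, if_pos (by rw [hrec.self x hx]; exact Nat.zero_le _)]
    omega
  · by_cases hss : s' = s
    · subst hss
      rw [hidxs v hv]
      split_ifs
      exacts [by omega, hne]
    · rwa [hidx'' v hv s' hs' hss]

/-- Append the set at the position in registers `12` and `14` to the list if it passes the test and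
has not been listed. -/
def listStep : Prog :=
  .seq (sumLoop 8 10 0 (.not (.lt (.var 14) (.get 7 (.row (.var 12) 0 (.var 10))))))
    (.seq (sumLoop 9 10 0 (.mul (.not (.lt (.var 14) (.get 8 (.row (.var 12) 0 (.var 10)))))
        (.lt (.var 14) (.get 7 (.row (.var 12) 0 (.var 10))))))
      (.cond (.mul (.mul (.eq (.var 8) (.var 14)) (.eq (.var 9) (.lit 0)))
          (.eq (.get 9 (.row (.var 12) 2 (.var 14))) (.lit 0))) emit .skip))

theorem run_listStep {C Q : ℕ → ℕ} {x s : ℕ} (hrec : Recentering n C Q) (hN : σ.reg 1 + 1 ≤ N)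
    (h0 : σ.reg 0 = n) (h2 : σ.reg 2 = n + 1) (h12 : σ.reg 12 = x) (h14 : σ.reg 14 = s)
    (hC : σ.mem 7 = C) (hQ : σ.mem 8 = Q) (hL : ListingState n C Q σ) (hx : x < n) (hs : s ≤ n) :
    Run N listStep σ (200 * n + 100) fun σ' => ListingState n C Q σ' ∧ σ'.reg 1 ≤ σ.reg 1 + 1 ∧
      (Good n C Q x s → σ'.mem 9 (x * (n + 1) + s) ≠ 0) ∧
      ∀ v < n, ∀ s' ≤ n, σ.mem 9 (v * (n + 1) + s') ≠ 0 → σ'.mem 9 (v * (n + 1) + s') ≠ 0 := by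
  refine Run.of_bdd fun _ hσ => ?_
  have hnN : n ≤ N := h0 ▸ hσ.1 0
  refine (Run.seq (Run.sumLoop (m := n) (fun z => 1 - if s < C (x * n + z) then 1 else 0) h0
    (by decide) (by decide) (by decide) (by decide) ?_ ?_) (t₂ := 150 * n + 80) ?_).mono
    (by simp [Expr.cost]; omega) fun _ _ _ h => h
  · intro z hz σ' hF hr
    simp only [Expr.eval, hr, hF.1 0 (by decide), hF.1 12 (by decide),
      hF.1 14 (by decide), hF.2 7 (by decide), h0, h12, h14, hC]
  · rw [sum_not_ite]
    exact (Finset.card_filter_le _ _).trans (by simpa)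
  intro σ₁ hF₁ h8
  rw [sum_not_ite] at h8
  simp only [not_lt] at h8
  have e0 : σ₁.reg 0 = n := by rw [hF₁.1 0 (by decide), h0]
  have e12 : σ₁.reg 12 = x := by rw [hF₁.1 12 (by decide), h12]
  have e14 : σ₁.reg 14 = s := by rw [hF₁.1 14 (by decide), h14]
  have eC : σ₁.mem 7 = C := by rw [hF₁.2 7 (by decide), hC]
  have eQ : σ₁.mem 8 = Q := by rw [hF₁.2 8 (by decide), hQ]
  refine (Run.seq (Run.sumLoop (m := n) (fun z => (1 - if s < Q (x * n + z) then 1 else 0) *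
    if s < C (x * n + z) then 1 else 0) e0
    (by decide) (by decide) (by decide) (by decide) ?_ ?_) (t₂ := 100 * n + 60) ?_).mono
    (by simp [Expr.cost]; omega) fun _ _ _ h => h
  · intro z hz σ' hF hr
    simp only [Expr.eval, hr, hF.1 0 (by decide), hF.1 12 (by decide),
      hF.1 14 (by decide), hF.2 7 (by decide), hF.2 8 (by decide), e0, e12, e14, eC, eQ]
  · refine ((Finset.sum_le_card_nsmul _ _ 1 fun z _ => ?_).trans (by simp)).trans hnN
    split_ifs <;> simp
  intro σ₂ hF₂ h9
  have f8 : σ₂.reg 8 = _ := (hF₂.1 8 (by decide)).trans h8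
  have fr (r : ℕ) (hr : r ∉ [8, 9, 10]) : σ₂.reg r = σ.reg r := by
    simp only [List.mem_cons, List.not_mem_nil, or_false, not_or] at hr
    rw [hF₂.1 r (by simp [sumLoop, forLoop, Prog.regs, hr]),
      hF₁.1 r (by simp [sumLoop, forLoop, Prog.regs, hr])]
  have fm (a : ℕ) : σ₂.mem a = σ.mem a := by
    rw [hF₂.2 a (by simp [sumLoop, forLoop, Prog.arrs]),
      hF₁.2 a (by simp [sumLoop, forLoop, Prog.arrs])]
  -- Register 8 counts the ball, and register 9 counts the y with Q ≤ s < C, the violations of the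
  -- second condition.
  have hgood : Good n C Q x s ↔ σ₂.reg 8 = s ∧ σ₂.reg 9 = 0 := by
    rw [Good, f8, h9, Finset.sum_eq_zero_iff]
    refine and_congr_right fun _ => forall_congr' fun y => ?_
    rw [Finset.mem_range]
    refine imp_congr_right fun _ => ?_
    rw [mul_eq_zero]
    by_cases h1 : Q (x * n + y) ≤ s <;> by_cases h2 : C (x * n + y) ≤ s <;>
      simp [h1, h2, not_le.1, lt_iff_not_ge]
  have hL₂ : ListingState n C Q σ₂ := by
    simpa only [ListingState, fm, fr 1 (by decide)] using hL
  have hb : Expr.eval σ₂ (.mul (.mul (.eq (.var 8) (.var 14)) (.eq (.var 9) (.lit 0)))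
      (.eq (.get 9 (.row (.var 12) 2 (.var 14))) (.lit 0))) ≠ 0 ↔
      Good n C Q x s ∧ σ.mem 9 (x * (n + 1) + s) = 0 := by
    simp only [Expr.eval, fr 14 (by decide), fr 12 (by decide), fr 2 (by decide), h14, h12, h2, fm,
      hgood, mul_ne_zero_iff]
    by_cases h9' : σ₂.reg 9 = 0 <;> simp [h9']
  refine (Run.cond (t := 100 * n + 40) (by decide) (fun h => ?_) (fun h => ?_)).mono
    (by simp [Expr.cost]; omega) fun _ _ _ h => h
  · obtain ⟨h3, h4⟩ := hb.1 h
    refine (run_emit hrec (by rwa [fr 1 (by decide)]) (by rw [fr 0 (by decide), h0])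
      (by rw [fr 2 (by decide), h2]) (by rw [fr 12 (by decide), h12])
      (by rw [fr 14 (by decide), h14]) (by rw [fm, hC]) hL₂ hx hs h3
      (by rw [fm, h4])).mono le_rfl ?_
    rintro σ' - - ⟨i1, i2, i3, i4⟩
    rw [fr 1 (by decide)] at i2
    simp only [fm] at i4
    exact ⟨i1, i2.le, fun _ => i3, i4⟩
  · refine (Run.skip ?_).mono (by omega) fun _ _ _ h => h
    simp only [fm, fr 1 (by decide)]
    refine ⟨hL₂, by omega, fun hg h' => ?_, fun _ _ _ _ h => h⟩
    exact hb.2 ⟨hg, h'⟩ h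

/-- List the strong sets. -/
def listAll : Prog :=
  .seq (.assign 2 (.add (.var 0) (.lit 1)))
    (.seq (.assign 1 (.lit 0)) (forLoop 12 0 (forLoop 14 2 listStep)))

/-- Each position (x, s) appends at most one set. The resulting crude bound n(n + 1) on the number
of sets already suffices, for the time as well as for the word size, because one append is linear.
-/
theorem run_listAll {C Q : ℕ → ℕ} (hrec : Recentering n C Q) (hN : (n + 1) * (n + 1) ≤ N)
    (h0 : σ.reg 0 = n) (hC : σ.mem 7 = C) (hQ : σ.mem 8 = Q) (hidx : ∀ i, σ.mem 9 i = 0) :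
    Run N listAll σ (400 * (n + 1) ^ 3) fun σ' => ListingState n C Q σ' ∧ σ'.reg 2 = n + 1 ∧
      σ'.reg 1 ≤ n * (n + 1) ∧
      ∀ x < n, ∀ s ≤ n, Good n C Q x s → σ'.mem 9 (x * (n + 1) + s) ≠ 0 := by
  refine (Run.seq (R := fun σ' => σ' = σ.setReg 2 (n + 1)) (t₂ := 390 * (n + 1) ^ 3)
    (Run.assign (by decide) (fun _ => by simp only [Expr.eval, h0]; nlinarith)
      (by simp [Expr.eval, h0])) ?_).mono
    (by simp [Expr.cost]; ring_nf; omega) fun _ _ _ h => h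
  rintro σ₁ - rfl
  refine (Run.seq (R := fun σ' => σ' = (σ.setReg 2 (n + 1)).setReg 1 0) (t₂ := 380 * (n + 1) ^ 3)
    (Run.assign (by decide) (fun _ => Nat.zero_le _) (by simp [Expr.eval])) ?_).mono
    (by simp [Expr.cost]; ring_nf; omega) fun _ _ _ h => h
  rintro σ₂ - rfl
  refine (Run.forLoop (m := n) (T := (n + 1) * (200 * n + 100 + 8) + 6)
    (p := forLoop 14 2 listStep) (fun k σ' => ListingState n C Q σ' ∧
      σ'.reg 1 ≤ k * (n + 1) ∧
      ∀ x < k, ∀ s ≤ n, Good n C Q x s → σ'.mem 9 (x * (n + 1) + s) ≠ 0) (by simp [h0]) (by decide)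
    (by decide) (by decide) ?_ ?_).mono (by ring_nf; omega) ?_
  · refine ⟨⟨?_, ?_, ?_, ?_⟩, ?_, ?_⟩ <;> simp [hidx]
  · intro x hx σ₃ hF₃ hr₃ ⟨hL, hk, hdone⟩
    have e0 : σ₃.reg 0 = n := by rw [hF₃.1 0 (by decide)]; simp [h0]
    have e2 : σ₃.reg 2 = n + 1 := by rw [hF₃.1 2 (by decide)]; simp
    have eC : σ₃.mem 7 = C := by rw [hF₃.2 7 (by decide)]; simp [hC]
    have eQ : σ₃.mem 8 = Q := by rw [hF₃.2 8 (by decide)]; simp [hQ]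
    refine (Run.forLoop (m := n + 1) (T := 200 * n + 100) (p := listStep)
      (fun l σ' => ListingState n C Q σ' ∧ σ'.reg 1 ≤ x * (n + 1) + l ∧
        (∀ x' < x, ∀ s ≤ n, Good n C Q x' s → σ'.mem 9 (x' * (n + 1) + s) ≠ 0) ∧
        ∀ s < l, Good n C Q x s → σ'.mem 9 (x * (n + 1) + s) ≠ 0) e2 (by decide)
      (by decide) (by decide) ?_ ?_).mono le_rfl ?_
    · exact ⟨by simpa [ListingState] using hL, by simpa using hk, by simpa using hdone, by simp⟩
    · intro s hs σ₄ hF₄ hr₄ ⟨hL, hk, hdone, hdone'⟩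
      have hxn := Nat.mul_le_mul_right (n + 1) (Nat.succ_le_of_lt hx)
      rw [Nat.succ_mul] at hxn
      have hnn : (n + 1) * (n + 1) = n * (n + 1) + (n + 1) := by ring
      refine (run_listStep hrec (by omega) (by rw [hF₄.1 0 (by decide), e0])
        (by rw [hF₄.1 2 (by decide), e2]) (by rw [hF₄.1 12 (by decide), hr₃]) hr₄
        (by rw [hF₄.2 7 (by decide), eC]) (by rw [hF₄.2 8 (by decide), eQ]) hL hx
        (by omega)).mono le_rfl ?_
      rintro σ' - - ⟨i1, i2, i3, i4⟩
      refine ⟨by simpa [ListingState] using i1, by simp; omega, fun x' hx' s' hs' hg => ?_,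
        fun s' hs' hg => ?_⟩
      · exact i4 x' (by omega) s' hs' (hdone x' hx' s' hs' hg)
      · rcases Nat.lt_succ_iff_lt_or_eq.1 hs' with hlt | rfl
        · exact i4 x hx s' (by omega) (hdone' s' hlt hg)
        · exact i3 hg
    · rintro σ' - - ⟨i1, i2, i3, i4⟩
      refine ⟨by simpa [ListingState] using i1, by simp; linarith, fun x' hx' s hs hg => ?_⟩
      rcases Nat.lt_succ_iff_lt_or_eq.1 hx' with hlt | rfl
      · exact i3 x' hlt s hs hg
      · exact i4 s (by omega) hg
  · rintro σ' hF - ⟨i1, i2, i3⟩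
    exact ⟨i1, by rw [hF.1 2 (by decide)]; simp, i2, i3⟩

end RAM

namespace RAM

variable {N n : ℕ} {σ : State}

/-! ### Parents -/

/-- `v` is the predecessor of the first nonzero entry among the entries `f s` with `lo < s < hi`, or
`k` if there is none. -/
def IsFirstEntry (f : ℕ → ℕ) (k lo hi v : ℕ) : Prop :=
  (v = k ∧ ∀ s < hi, lo < s → f s = 0) ∨
    ∃ s < hi, lo < s ∧ f s = v + 1 ∧ ∀ s' < s, lo < s' → f s' = 0

/-- Look for the parent of the set with the index in register `12` among the sets of the size in
register `14`. -/
def parentStep : Prog :=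
  .cond (.mul (.mul (.lt (.get 11 (.var 12)) (.var 14))
      (.lt (.lit 0) (.get 9 (.row (.get 10 (.var 12)) 2 (.var 14))))) (.eq (.var 8) (.var 1)))
    (.assign 8 (.sub (.get 9 (.row (.get 10 (.var 12)) 2 (.var 14))) (.lit 1))) .skip

/-- Compute in array `2` the indices of the parents. -/
def parentAll : Prog :=
  forLoop 12 1 (.seq (.assign 8 (.var 1)) (.seq (forLoop 14 2 parentStep)
    (.store 2 (.var 12) (.var 8))))

/-- The strong sets containing a given representative form a chain with distinct sizes, so the first
nonzero entry beyond the size of set i in the row of its representative is its parent. The value k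
means both that nothing has been found yet and that the set is the root. -/
theorem run_parentAll {idx rep size : ℕ → ℕ} {k : ℕ} (hk : k ≤ n * (n + 1))
    (h1 : σ.reg 1 = k) (h2 : σ.reg 2 = n + 1) (hidx : σ.mem 9 = idx) (hrep : σ.mem 10 = rep)
    (hsize : σ.mem 11 = size) (hle : ∀ i < k, ∀ s ≤ n, idx (rep i * (n + 1) + s) ≤ k) :
    Run N parentAll σ (100 * (n + 1) ^ 3) fun σ' => ∀ i < k,
      IsFirstEntry (fun s => idx (rep i * (n + 1) + s)) k (size i) (n + 1) (σ'.mem 2 i) := by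
  refine (Run.forLoop (m := k) (T := 2 + ((n + 1) * (30 + 8) + 6 + 3))
    (fun k' σ' => ∀ i < k', IsFirstEntry (fun s => idx (rep i * (n + 1) + s)) k (size i) (n + 1)
      (σ'.mem 2 i)) h1 (by decide) (by decide) (by decide)
    (fun _ h => absurd h (Nat.not_lt_zero _)) ?_).mono ?_ fun _ _ _ h => h
  swap
  · calc _ ≤ n * (n + 1) * (2 + ((n + 1) * (30 + 8) + 6 + 3) + 8) + 6 :=
        Nat.add_le_add_right (Nat.mul_le_mul_right _ hk) _
      _ ≤ _ := by ring_nf; omega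
  intro i hi σ₁ hF₁ hr₁ hI
  refine (Run.seq (R := fun σ' => σ' = σ₁.setReg 8 k) (Run.assign (by decide) (fun hB => hB.1 1)
    (by simp [Expr.eval, hF₁.1 1 (by decide), h1])) ?_)
  rintro σ₂ - rfl
  have e1 : (σ₁.setReg 8 k).reg 1 = k := by simp [hF₁.1 1 (by decide), h1]
  have e2 : (σ₁.setReg 8 k).reg 2 = n + 1 := by simp [hF₁.1 2 (by decide), h2]
  have e12 : (σ₁.setReg 8 k).reg 12 = i := by simp [hr₁]
  have e9 : (σ₁.setReg 8 k).mem 9 = idx := by simp [hF₁.2 9 (by decide), hidx]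
  have e10 : (σ₁.setReg 8 k).mem 10 = rep := by simp [hF₁.2 10 (by decide), hrep]
  have e11 : (σ₁.setReg 8 k).mem 11 = size := by simp [hF₁.2 11 (by decide), hsize]
  have e8 : (σ₁.setReg 8 k).reg 8 = k := by simp
  have eM : (σ₁.setReg 8 k).mem 2 = σ₁.mem 2 := by simp
  generalize σ₁.setReg 8 k = σ₂ at *
  refine (Run.forLoop (m := n + 1) (T := 30) (p := parentStep) (fun t σ' =>
    IsFirstEntry (fun s => idx (rep i * (n + 1) + s)) k (size i) t (σ'.reg 8)) e2 (by decide)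
    (by decide) (by decide) (.inl ⟨by simpa using e8, by simp⟩) ?_).seq ?_
  · intro s hs σ₃ hF₃ hr₃ hI₃
    have f1 : σ₃.reg 1 = k := by rw [hF₃.1 1 (by decide), e1]
    have f2 : σ₃.reg 2 = n + 1 := by rw [hF₃.1 2 (by decide), e2]
    have f12 : σ₃.reg 12 = i := by rw [hF₃.1 12 (by decide), e12]
    have f9 : σ₃.mem 9 = idx := by rw [hF₃.2 9 (by decide), e9]
    have f10 : σ₃.mem 10 = rep := by rw [hF₃.2 10 (by decide), e10]
    have f11 : σ₃.mem 11 = size := by rw [hF₃.2 11 (by decide), e11]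
    have hb : Expr.eval σ₃ (.mul (.mul (.lt (.get 11 (.var 12)) (.var 14))
        (.lt (.lit 0) (.get 9 (.row (.get 10 (.var 12)) 2 (.var 14))))) (.eq (.var 8) (.var 1))) ≠ 0
        ↔ size i < s ∧ idx (rep i * (n + 1) + s) ≠ 0 ∧ σ₃.reg 8 = k := by
      simp only [Expr.eval, f1, f2, f12, f9, f10, f11, hr₃, mul_ne_zero_iff, Nat.pos_iff_ne_zero,
        and_assoc]
      refine and_congr (by simp) (and_congr (by simp) (by simp))
    refine (Run.cond (t := 10) (by decide) (fun h => ?_) (fun h => ?_)).mono (by simp [Expr.cost])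
      fun _ _ _ h => h
    · obtain ⟨i1, i2, i3⟩ := hb.1 h
      refine (Run.assign (by decide) (fun hB => (Nat.sub_le _ _).trans (hB.2 _ _)) ?_).mono
        (by simp [Expr.cost]) fun _ _ _ h => h
      simp only [Expr.eval, f2, f12, f9, f10, hr₃, State.setReg_reg, if_true, if_false,
        show (8 : ℕ) ≠ 14 by decide]
      refine .inr ⟨s, by omega, i1, by beta_reduce; omega, ?_⟩
      -- An entry found earlier would be v + 1 ≤ k, so register 8 would hold a value below k,
      -- contrary to the test.
      rcases hI₃ with ⟨-, h⟩ | ⟨s', hs', h5, h6, -⟩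
      · exact h
      · have := hle i hi s' (by omega)
        beta_reduce at h6
        omega
    · refine (Run.skip ?_).mono (by omega) fun _ _ _ h => h
      simp only [State.setReg_reg, if_false, show (8 : ℕ) ≠ 14 by decide]
      rcases hI₃ with ⟨h4, h5⟩ | ⟨s', hs', h5⟩
      · refine .inl ⟨h4, fun s' hs' hlo => ?_⟩
        rcases Nat.lt_succ_iff_lt_or_eq.1 hs' with hlt | rfl
        · exact h5 s' hlt hlo
        · by_contra hne
          exact hb.2 ⟨hlo, hne, h4⟩ h
      · exact .inr ⟨s', by omega, h5⟩
  · intro σ₄ hF₄ hfirst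
    refine Run.store (by decide) (by decide) (fun hB => hB.1 8) ?_
    simp only [Expr.eval, hF₄.1 12 (by decide), e12, State.setReg_mem, State.setMem_mem_self,
      hF₄.2 2 (by decide), eM, Function.update_apply]
    intro i' hi'
    split_ifs with hii
    · rw [hii]
      exact hfirst
    · exact hI i' (by omega)

/-! ### The whole program -/

/-- The program that computes the tree of strong sets. -/
def strongTree : Prog :=
  .seq refineAll (.seq countAll (.seq minAll (.seq listAll parentAll)))

/-- The content of the final memory. -/
structure Output (n : ℕ) (C Q : ℕ → ℕ) (σ : State) : Prop where
  listing : ListingState n C Q σ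
  complete : ∀ x < n, ∀ s ≤ n, Good n C Q x s → σ.mem 9 (x * (n + 1) + s) ≠ 0
  parent : ∀ i < σ.reg 1, IsFirstEntry (fun s => σ.mem 9 (σ.mem 10 i * (n + 1) + s)) (σ.reg 1)
    (σ.mem 11 i) (n + 1) (σ.mem 2 i)

/-- What the tables `P`, `C` and `Q` contain. -/
structure Tables (n : ℕ) (tab P C Q : ℕ → ℕ) : Prop where
  refine : ∀ z < n, ∀ x < n, ∀ y < n, P (z * n + x) = P (z * n + y) ↔
    (x = z ∧ y = z) ∨ TableTogether n tab z x y
  count : ∀ x < n, ∀ y < n, C (x * n + y) =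
    ((Finset.range n).filter fun z => ¬ P (z * n + x) = P (z * n + y)).card
  min : ∀ x < n, ∀ y < n, ∀ s ≤ n, Q (x * n + y) ≤ s ↔
    ∃ z < n, Incomparable n P x y z ∧ C (x * n + z) ≤ s

theorem run_strongTree {tab : ℕ → ℕ} (hN : (n + 2) ^ 2 ≤ N) (h0 : σ.reg 0 = n)
    (htab : σ.mem 0 = tab) (hidx : ∀ i, σ.mem 9 i = 0)
    (hrec : ∀ P C Q, Tables n tab P C Q → Recentering n C Q) :
    Run N strongTree σ (2720 * (n + 1) ^ 3) fun σ' =>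
      ∃ P C Q, Tables n tab P C Q ∧ Output n C Q σ' := by
  have hN₁ : n + 2 ≤ N := le_trans (by nlinarith) hN
  refine ((run_refineAll (tab := tab) hN₁ h0 htab).seq (t₂ := 700 * (n + 1) ^ 3) ?_).mono
    (by omega) fun _ _ _ h => h
  intro σ₁ hF₁ hP
  have e0 : σ₁.reg 0 = n := by rw [hF₁.1 0 (by decide), h0]
  refine ((run_countAll e0 rfl).seq (t₂ := 600 * (n + 1) ^ 3) ?_).mono
    (by omega) fun _ _ _ h => h
  intro σ₂ hF₂ hC
  have f0 : σ₂.reg 0 = n := by rw [hF₂.1 0 (by decide), e0]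
  have f6 : σ₂.mem 6 = σ₁.mem 6 := hF₂.2 6 (by decide)
  refine ((run_minAll hN₁ f0 f6 rfl).seq (t₂ := 500 * (n + 1) ^ 3) ?_).mono
    (by omega) fun _ _ _ h => h
  intro σ₃ hF₃ hQ
  have g0 : σ₃.reg 0 = n := by rw [hF₃.1 0 (by decide), f0]
  have g7 : σ₃.mem 7 = σ₂.mem 7 := hF₃.2 7 (by decide)
  have g9 (i : ℕ) : σ₃.mem 9 i = 0 := by
    rw [hF₃.2 9 (by decide), hF₂.2 9 (by decide), hF₁.2 9 (by decide), hidx]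
  have htables : Tables n tab (σ₁.mem 6) (σ₂.mem 7) (σ₃.mem 8) := ⟨hP, hC, hQ⟩
  refine ((run_listAll (hrec _ _ _ htables) (le_trans (by nlinarith) hN) g0 g7 rfl g9).seq
    (t₂ := 100 * (n + 1) ^ 3) ?_).mono (by omega) fun _ _ _ h => h
  rintro σ₄ - ⟨hL, h2, hk, hcomp⟩
  refine (run_parentAll hk rfl h2 rfl rfl rfl ?_).mono le_rfl fun σ₅ hF₅ _ hpar =>
    ⟨_, _, _, htables, ?_, ?_, ?_⟩
  · intro i hi s hs
    by_cases h : σ₄.mem 9 (σ₄.mem 10 i * (n + 1) + s) = 0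
    · omega
    · obtain ⟨j, hj, h', -⟩ := hL.idx_mem _ (hL.good i hi).1 s hs h
      omega
  · simpa only [ListingState, hF₅.2 1 (by decide), hF₅.2 9 (by decide), hF₅.2 10 (by decide),
      hF₅.2 11 (by decide), hF₅.1 1 (by decide)] using hL
  · simpa only [hF₅.2 9 (by decide)] using hcomp
  · simpa only [hF₅.2 9 (by decide), hF₅.2 10 (by decide),
      hF₅.2 11 (by decide), hF₅.1 1 (by decide)] using hpar

end RAM

/-! ### From numbers to elements -/

section Transfer

variable {V : Type*} [Fintype V] {e : V ≃ Fin (Fintype.card V)} {H : HomogeneousRelation V}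
  {table P C Q : ℕ → ℕ}

theorem exists_index_eq (e : V ≃ Fin (Fintype.card V)) {i : ℕ} (hi : i < Fintype.card V) :
    ∃ v, (e v : ℕ) = i :=
  ⟨e.symm ⟨i, hi⟩, by simp⟩

theorem index_inj {x y : V} : (e x : ℕ) = e y ↔ x = y := by
  rw [Fin.val_inj, e.apply_eq_iff_eq]

theorem card_filter_range_eq_ncard (e : V ≃ Fin (Fintype.card V)) (p : ℕ → Prop) [DecidablePred p]
    {S : Set V} (h : ∀ v, p (e v) ↔ v ∈ S) :
    ((Finset.range (Fintype.card V)).filter p).card = S.ncard := by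
  have himage : (((Finset.range (Fintype.card V)).filter p : Finset ℕ) : Set ℕ) =
      (fun v => (e v : ℕ)) '' S := by
    ext i
    simp only [Finset.coe_filter, Finset.mem_range, Set.mem_ofPred_eq, Set.mem_image]
    constructor
    · rintro ⟨hi, hp⟩
      obtain ⟨v, rfl⟩ := exists_index_eq e hi
      exact ⟨v, (h v).1 hp, rfl⟩
    · rintro ⟨v, hv, rfl⟩
      exact ⟨(e v).2, (h v).2 hv⟩
  rw [← Set.ncard_coe_finset, himage, Set.ncard_image_of_injective _ fun x y h => index_inj.1 h]

theorem together_iff (hT : PresentsRelation e H table) (z x y : V) :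
    H.Together z x y ↔ TableTogether (Fintype.card V) table (e z) (e x) (e y) := by
  constructor
  · rintro ⟨X, hX, hz, hx, hy⟩
    have hmem (v : V) : (e v : ℕ) ∈ (fun v => (e v : ℕ)) '' X ↔ v ∈ X :=
      ⟨fun ⟨w, hw, h⟩ => index_inj.1 h ▸ hw, fun h => ⟨v, h, rfl⟩⟩
    refine ⟨(fun v => (e v : ℕ)) '' X, ?_, ?_, (hmem z).not.2 hz, (hmem x).2 hx, (hmem y).2 hy⟩
    · rintro s hs hsX _ ⟨a, ha, rfl⟩ _ ⟨b, hb, rfl⟩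
      obtain ⟨s, rfl⟩ := exists_index_eq e hs
      have hrel := hX.2 s ((hmem s).not.1 hsX) a ha b hb
      obtain ⟨h1, h2⟩ := H.reflectless s a b hrel
      exact (hT.1 s a b h1 h2).2 hrel
    · rintro _ ⟨a, -, rfl⟩
      exact (e a).2
  · rintro ⟨X, hX, -, hz, hx, hy⟩
    refine ⟨{v | (e v : ℕ) ∈ X}, ⟨⟨x, hx⟩, fun s hs a ha b hb => ?_⟩, hz, hx, hy⟩
    refine (hT.1 s a b ?_ ?_).1 (hX (e s) (e s).2 hs _ ha _ hb)
    · rintro rfl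
      exact hs ha
    · rintro rfl
      exact hs hb

theorem RAM.Tables.row_eq_iff (hT : PresentsRelation e H table)
    (h : RAM.Tables (Fintype.card V) table P C Q) (z x y : V) :
    P (e z * Fintype.card V + e x) = P (e z * Fintype.card V + e y) ↔
      (x = z ∧ y = z) ∨ H.Together z x y := by
  rw [h.refine _ (e z).2 _ (e x).2 _ (e y).2, together_iff hT, index_inj, index_inj]

theorem RAM.Tables.count_eq (hT : PresentsRelation e H table)
    (h : RAM.Tables (Fintype.card V) table P C Q) (x y : V) :
    C (e x * Fintype.card V + e y) = H.dist x y := by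
  rw [h.count _ (e x).2 _ (e y).2, HomogeneousRelation.dist]
  split_ifs with hxy
  · simp [hxy]
  · refine card_filter_range_eq_ncard e _ fun z => ?_
    rw [h.row_eq_iff hT, or_iff_right]
    · rfl
    · rintro ⟨rfl, rfl⟩
      exact hxy rfl

theorem RAM.Tables.good_iff (hT : PresentsRelation e H table)
    (h : RAM.Tables (Fintype.card V) table P C Q) (x : V) {s : ℕ} (hs : s ≤ Fintype.card V) :
    RAM.Good (Fintype.card V) C Q (e x) s ↔ H.IsStrongBall x s := by
  have hball (z : V) : C (e x * Fintype.card V + e z) ≤ s ↔ z ∈ H.ball x s := by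
    rw [h.count_eq hT]
    rfl
  rw [RAM.Good, HomogeneousRelation.IsStrongBall, card_filter_range_eq_ncard e _ hball]
  refine and_congr_right fun _ => ?_
  -- A row z also identifies z with itself. These degenerate coincidences would force y = x, but x
  -- lies in its own ball.
  have hne {y z : V} (hy : y ∉ H.ball x s) : ¬ (z = x ∧ y = x) ∧ ¬ (x = z ∧ y = z) := by
    have hyx : y ≠ x := by
      rintro rfl
      exact hy (H.self_mem_ball y s)
    exact ⟨fun h => hyx h.2, fun h => hyx (h.2.trans h.1.symm)⟩
  constructor
  · intro hall y z hz hy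
    rw [← not_or]
    intro hcon
    refine hy ((hball y).1 (hall _ (e y).2 ((h.min _ (e x).2 _ (e y).2 s hs).2
      ⟨e z, (e z).2, ?_, (hball z).2 hz⟩)))
    rw [RAM.Incomparable, h.row_eq_iff hT, h.row_eq_iff hT]
    exact hcon.imp .inr .inr
  · intro hall i hi hQ
    obtain ⟨y, rfl⟩ := exists_index_eq e hi
    obtain ⟨j, hj, hinc, hz⟩ := (h.min _ (e x).2 _ (e y).2 s hs).1 hQ
    obtain ⟨z, rfl⟩ := exists_index_eq e hj
    rw [hball] at hz ⊢
    by_contra hy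
    rw [RAM.Incomparable, h.row_eq_iff hT, h.row_eq_iff hT, or_iff_right (hne hy).2,
      or_iff_right (hne hy).1] at hinc
    exact hinc.elim (hall y z hz hy).1 (hall y z hz hy).2

theorem RAM.Tables.recentering (hT : PresentsRelation e H table)
    (h : RAM.Tables (Fintype.card V) table P C Q) : RAM.Recentering (Fintype.card V) C Q where
  self i hi := by
    obtain ⟨x, rfl⟩ := exists_index_eq e hi
    rw [h.count_eq hT]
    simp [HomogeneousRelation.dist]
  recenter i hi s hs hgood j hj hC := by
    obtain ⟨x, rfl⟩ := exists_index_eq e hi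
    obtain ⟨v, rfl⟩ := exists_index_eq e hj
    rw [h.good_iff hT _ hs] at hgood ⊢
    rw [h.count_eq hT] at hC
    obtain ⟨h1, h2⟩ := hgood.recenter hC
    refine ⟨h1, fun l hl => ?_⟩
    obtain ⟨w, rfl⟩ := exists_index_eq e hl
    rw [h.count_eq hT, h.count_eq hT]
    exact Set.ext_iff.1 h2 w

end Transfer

/-! ### Correctness of the output -/

/-- Strong sets that meet are nested, and then cardinality decides which one is the smaller. -/
theorem IsStrong.subset_of_ncard_le {V : Type*} [Finite V] {F : Set (Set V)} {A B : Set V}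
    (hA : IsStrong F A) (hB : IsStrong F B) (hAB : (A ∩ B).Nonempty) (hle : A.ncard ≤ B.ncard) :
    A ⊆ B := by
  by_contra hsub
  have hBA : B ⊆ A := by
    by_contra hsub'
    exact hA.2 B hB.1 ⟨hAB, Set.sdiff_nonempty.2 hsub, Set.sdiff_nonempty.2 hsub'⟩
  exact hsub (Set.eq_of_subset_of_ncard_le hBA hle).ge

theorem isStrong_univ {V : Type*} [Nonempty V] (H : HomogeneousRelation V) :
    IsStrong H.family Set.univ :=
  ⟨⟨Set.univ_nonempty, fun s hs => absurd (Set.mem_univ s) hs⟩,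
    fun _ _ h => h.2.2.elim fun _ hv => hv.2 (Set.mem_univ _)⟩

/-- A strong set M is found through the entry (v, |M|) for any v ∈ M: it is nonzero by completeness
and names a listed strong set of the same size that also contains v, hence M itself. The same entry
determines the index, which gives uniqueness. -/
theorem RAM.Output.outputsStrongTree {V : Type*} [Fintype V] {e : V ≃ Fin (Fintype.card V)}
    {H : HomogeneousRelation V} {table P C Q : ℕ → ℕ} {σ : RAM.State}
    (hT : PresentsRelation e H table) (h : RAM.Tables (Fintype.card V) table P C Q)
    (hO : RAM.Output (Fintype.card V) C Q σ) : OutputsStrongTree e H.family σ := by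
  have hncard (M : Set V) : M.ncard ≤ Fintype.card V := by
    rw [← Nat.card_eq_fintype_card]
    exact Set.ncard_le_card M
  have hset : ∀ i < σ.reg 1, ∃ x : V, (e x : ℕ) = σ.mem 10 i ∧ x ∈ outputSet e σ i ∧
      IsStrong H.family (outputSet e σ i) ∧ (outputSet e σ i).ncard = σ.mem 11 i := by
    intro i hi
    obtain ⟨h1, h2, h3⟩ := hO.listing.good i hi
    obtain ⟨x, hx⟩ := exists_index_eq e h1
    rw [← hx, h.good_iff hT _ h2] at h3
    have hball : outputSet e σ i = H.ball x (σ.mem 11 i) := by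
      ext v
      refine (hO.listing.out_iff i hi (e v) (e v).2).trans ?_
      rw [← hx, h.count_eq hT]
      rfl
    rw [hball]
    exact ⟨x, hx, H.self_mem_ball x _, h3.isStrong, h3.1⟩
  have hentry {M : Set V} (hM : IsStrong H.family M) {v : V} (hv : v ∈ M) :
      σ.mem 9 (e v * (Fintype.card V + 1) + M.ncard) ≠ 0 :=
    hO.complete (e v) (e v).2 _ (hncard M)
      ((h.good_iff hT v (hncard M)).2 (HomogeneousRelation.isStrongBall_ncard_of_isStrong hM hv))
  have hmem : ∀ v : V, ∀ s ≤ Fintype.card V, σ.mem 9 (e v * (Fintype.card V + 1) + s) ≠ 0 →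
      ∃ i < σ.reg 1, σ.mem 9 (e v * (Fintype.card V + 1) + s) = i + 1 ∧
        v ∈ outputSet e σ i ∧ (outputSet e σ i).ncard = s := by
    intro v s hs hne
    obtain ⟨i, hi, h1, h2, h3⟩ := hO.listing.idx_mem (e v) (e v).2 s hs hne
    obtain ⟨x, -, -, -, h4⟩ := hset i hi
    exact ⟨i, hi, h1, (hO.listing.out_iff i hi (e v) (e v).2).2 (by rwa [h2]), by rw [h4, h2]⟩
  refine ⟨fun i hi => ?_, fun M hM => ?_, fun i hi => ?_⟩
  · obtain ⟨x, -, -, hstrong, -⟩ := hset i hi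
    exact hstrong
  · obtain ⟨v, hv⟩ := hM.1.1
    obtain ⟨i, hi, h1, h2, h3⟩ := hmem v _ (hncard M) (hentry hM hv)
    obtain ⟨-, -, -, hstrong, -⟩ := hset i hi
    refine ⟨i, ⟨hi, Set.Subset.antisymm (hstrong.subset_of_ncard_le hM ⟨v, h2, hv⟩ h3.le)
      (hM.subset_of_ncard_le hstrong ⟨v, hv, h2⟩ h3.ge)⟩, ?_⟩
    rintro j ⟨hj, rfl⟩
    obtain ⟨-, -, -, -, h5⟩ := hset j hj
    have h6 := hO.listing.mem_idx j hj (e v) (e v).2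
      ((hO.listing.out_iff j hj (e v) (e v).2).1 hv)
    rw [← h5, h1] at h6
    omega
  · obtain ⟨x, hx, hxi, hstrong, hcard⟩ := hset i hi
    have hfirst := hO.parent i hi
    rw [← hx, ← hcard] at hfirst
    rcases hfirst with ⟨hroot, hzero⟩ | ⟨s, hs, hlt, heq, hzero⟩
    · refine .inl ⟨?_, hroot⟩
      have : Nonempty V := ⟨x⟩
      by_contra hne
      -- A set other than V has a larger nonzero entry in its row, namely the one of V.
      refine hentry (isStrong_univ H) (Set.mem_univ x) (hzero _ (Nat.lt_succ_of_le (hncard _)) ?_)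
      exact Set.ncard_lt_ncard (Set.ssubset_univ_iff.2 hne)
    · beta_reduce at heq
      obtain ⟨j, hj, h1, h2, h3⟩ := hmem x s (by omega) (by omega)
      obtain rfl : σ.mem 2 i = j := by omega
      obtain ⟨-, -, -, hstrong', -⟩ := hset _ hj
      refine .inr ⟨hj, hstrong', ?_, fun R hR hsub => ?_⟩
      · refine (hstrong.subset_of_ncard_le hstrong' ⟨x, hxi, h2⟩ (by omega)).ssubset_of_ne ?_
        intro h'
        rw [h'] at hlt
        omega
      · have hxR := hsub.1 hxi
        refine hstrong'.subset_of_ncard_le hR ⟨x, h2, hxR⟩ ?_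
        by_contra hcon
        -- A smaller strong R properly containing set i would have produced an earlier nonzero
        -- entry.
        exact hentry hR hxR (hzero _ (by omega) (Set.ncard_lt_ncard hsub))

theorem RAM.initialState_bdd {V : Type*} [Fintype V] {e : V ≃ Fin (Fintype.card V)}
    {H : HomogeneousRelation V} {table : ℕ → ℕ} (hT : PresentsRelation e H table) :
    (RAM.initialState (Fintype.card V) table).Bdd ((Fintype.card V + 2) ^ 2) := by
  have hle : Fintype.card V ≤ (Fintype.card V + 2) ^ 2 := by nlinarith
  refine ⟨fun r => ?_, fun a i => ?_⟩
  · simp only [RAM.initialState]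
    split_ifs
    exacts [hle, Nat.zero_le _]
  · simp only [RAM.initialState]
    split_ifs
    swap
    · exact Nat.zero_le _
    by_cases hi : i < Fintype.card V * Fintype.card V
    · have hpos : 0 < Fintype.card V := by
        by_contra h
        simp [Nat.eq_zero_of_not_pos h] at hi
      obtain ⟨s, hs⟩ := exists_index_eq e (Nat.div_lt_of_lt_mul hi)
      obtain ⟨x, hx⟩ := exists_index_eq e (Nat.mod_lt i hpos)
      have := hT.2.1 s x
      rw [hs, hx, Nat.div_add_mod'] at this
      omega
    · rw [hT.2.2 i (not_lt.1 hi)]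
      exact Nat.zero_le _

/-- The strong homogeneous sets of a homogeneous relation on `V`, together with their inclusion tree,
can be computed in `O(|V|³)` time: there is one word RAM program that does so in at most
`K * (|V| ^ 3 + 1)` steps, with words of `O(log |V|)` bits. -/
theorem mainTheorem4 :
    ∃ (P : RAM.Prog) (d K : ℕ),
      ∀ (V : Type*) [Fintype V] (e : V ≃ Fin (Fintype.card V)) (H : HomogeneousRelation V)
        (table : ℕ → ℕ), PresentsRelation e H table →
        ∃ (σ : RAM.State) (t : ℕ),
          RAM.Exec ((Fintype.card V + 2) ^ d) P
            (RAM.initialState (Fintype.card V) table) σ t ∧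
          t ≤ K * (Fintype.card V ^ 3 + 1) ∧
          OutputsStrongTree e H.family σ := by
  -- Contents are bounded by (n + 2)² and words by the power `maxCost` of that bound. The factor 4
  -- comes from (n + 1)³ ≤ 4(n³ + 1), whose difference is 3(n - 1)²(n + 1).
  refine ⟨RAM.strongTree, 2 * RAM.maxCost, 2720 * 4, ?_⟩
  intro V _ e H table hT
  obtain ⟨σ, t, hexec, ht, -, -, P, C, Q, htables, hout⟩ := RAM.run_strongTree (tab := table)
    (σ := RAM.initialState (Fintype.card V) table) le_rfl (by simp [RAM.initialState])
    (by simp [RAM.initialState]) (by simp [RAM.initialState])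
    (fun _ _ _ h => h.recentering hT)
    (le_trans (by norm_num) (Nat.pow_le_pow_left (Nat.le_add_left 2 _) 2))
    (RAM.initialState_bdd hT)
  refine ⟨σ, t, by rwa [pow_mul], ht.trans ?_, hout.outputsStrongTree hT htables⟩
  generalize Fintype.card V = n
  zify
  nlinarith [mul_nonneg (sq_nonneg ((n : ℤ) - 1)) (by positivity : (0 : ℤ) ≤ n + 1)]
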